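/- Let $d\ge 1$ and let $\Omega\subset\mathbb{R}^d$ be a bounded open set with boundary $\partial\Omega$. For $\theta\in\mathbb{S}^{d-1}$ let $H_\theta=\theta^\perp$, let $\mathcal P_\theta$ be the orthogonal projection onto $H_\theta$, and for $y\in H_\theta$ let $\omega_\theta(y)=\{s\in\mathbb{R}: s\theta+y\in\Omega\}$. For $x\in\Omega$ let $\delta_\theta(x)=\sup\{s\ge 0:\ x+t\theta\in\Omega\ \text{for all } t\in[0,s)\}$ and $\Phi_\theta(x)=x+\delta_\theta(x)\theta\in\partial\Omega$. Let $\mu_\theta$ be the Borel measure on $\partial\Omega$ given by $\mu_\theta(A)=\int_\Omega \chi_A(\Phi_\theta(x))\,dx$. A function $g:\partial\Omega\to\mathbb{R}$ is a directional trace of $u\in H^1(\Omega)$ in the direction $\theta$ if, for some representative of $u$ and for $\lambda^{d-1}$-almost every $y\in\mathcal P_\theta(\Omega)$, the function $s\mapsto u(s\theta+y)$ belongs to $H^1(\omega_\theta(y))$ and, for every connected component $(\alpha,\beta)$ of $\omega_\theta(y)$, $g(\beta\theta+y)$ is the value at $\beta$ of its continuous representative on $(\alpha,\beta]$. Let $L^2(\partial\Omega,(\mu_\theta)_\theta)$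 be the set of functions $g$ on $\partial\Omega$ that belong, up to modification on a $\mu_\theta$-negligible set, to $\mathcal L^2(\partial\Omega,\mu_\theta)$ for every $\theta\in\mathbb{S}^{d-1}$, with $\sup_\theta\int_{\partial\Omega} g^2\,d\mu_\theta<\infty$, two functions being identified if they are equal $\mu_\theta$-a.e. for every $\theta$; its norm is $\|g\|=\sup_{\theta}\|g\|_{L^2(\partial\Omega,\mu_\theta)}$. A function $u\in H^1(\Omega)$ has the omnidirectional trace $g=\mathrm{tr}(u)\in L^2(\partial\Omega,(\mu_\theta)_\theta)$ if for every $\theta\in\mathbb{S}^{d-1}$ the function $g$ is $\mu_\theta$-a.e. equal to a directional trace of $u$ in the direction $\theta$. Let $H^1_{\rm tr}(\Omega)$ be the set of $u\in H^1(\Omega)$ that have an omnidirectional trace, and $H^1_{\rm tr,0}(\Omega)=\{u\in H^1_{\rm tr}(\Omega):\mathrm{tr}(u)=0\}$. Let $H^1_0(\Omega)$ and $\widetilde H^1(\Omega)$ be the closures in $H^1(\Omega)$ of $C^\infty_c(\Omega)$ and of $H^1(\Omega)\cap C^0(\overline\Omega)$ respectively. Then $$H^1_0(\Omega)\subset H^1_{\rm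 tr,0}(\Omega)\subset \widetilde H^1(\Omega)\subset H^1_{\rm tr}(\Omega).$$ In particular, every $u\in\widetilde H^1(\Omega)$ has an omnidirectional trace, which is unique as an element of $L^2(\partial\Omega,(\mu_\theta)_\theta)$; and for every sequence $(u_n)$ in $H^1(\Omega)\cap C^0(\overline\Omega)$ that converges to $u$ in $H^1(\Omega)$, the restrictions $u_n|_{\partial\Omega}$ converge in $L^2(\partial\Omega,(\mu_\theta)_\theta)$ to $\mathrm{tr}(u)$, which is their only limit there. -/

import Mathlib

open MeasureTheory Set Filter Topology
open scoped ENNReal ContDiff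

noncomputable section

namespace OmniTrace

/-- The Euclidean space of dimension `d`. -/
abbrev Euc (d : ℕ) : Type := EuclideanSpace ℝ (Fin d)

/-! ### Test functions and weak directional derivatives -/

section Weak

variable {E : Type*} [NormedAddCommGroup E] [NormedSpace ℝ E]

/-- `φ ∈ C^∞_c(Ω)`: `φ` is smooth, with compact support contained in `Ω`. -/
structure IsTestFunction (Ω : Set E) (φ : E → ℝ) : Prop where
  smooth : ContDiff ℝ ∞ φ
  compact : HasCompactSupport φ
  supp : tsupport φ ⊆ Ω

/-- `w` is the derivative of `u` along `v` in the weak sense on `Ω`: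
`∫_Ω u ∂_v φ = - ∫_Ω w φ` for all `φ ∈ C^∞_c(Ω)`. -/
def IsWeakDirDeriv [MeasureSpace E] (Ω : Set E) (v : E) (u w : E → ℝ) : Prop :=
  ∀ φ : E → ℝ, IsTestFunction Ω φ →
    ∫ x in Ω, u x * fderiv ℝ φ x v = - ∫ x in Ω, w x * φ x

/-- `u ∈ W_v(Ω)`: `u ∈ L²(Ω)` and its weak derivative along `v` is in `L²(Ω)`.
For an open subset `ω` of `ℝ` and `v = 1` this is membership in `H¹(ω)`. -/
def MemW [MeasureSpace E] (Ω : Set E) (v : E) (u : E → ℝ) : Prop :=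
  MemLp u 2 (volume.restrict Ω) ∧
    ∃ w : E → ℝ, MemLp w 2 (volume.restrict Ω) ∧ IsWeakDirDeriv Ω v u w

end Weak

variable {d : ℕ}

/-! ### The Sobolev space `H¹(Ω)` -/

/-- `G` is the gradient of `u` on `Ω` in the sense of distributions. -/
def IsWeakGradient (Ω : Set (Euc d)) (u : Euc d → ℝ) (G : Euc d → Euc d) : Prop :=
  ∀ v : Euc d, IsWeakDirDeriv Ω v u (fun x => inner ℝ (G x) v)

theorem IsTestFunction.memLp {Ω : Set (Euc d)} {φ : Euc d → ℝ} (h : IsTestFunction Ω φ) :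
    MemLp φ 2 (volume.restrict Ω) :=
  (h.smooth.continuous.memLp_of_hasCompactSupport h.compact).restrict Ω

theorem IsTestFunction.memLp_fderiv {Ω : Set (Euc d)} {φ : Euc d → ℝ}
    (h : IsTestFunction Ω φ) (v : Euc d) :
    MemLp (fun x => fderiv ℝ φ x v) 2 (volume.restrict Ω) := by
  have hc : Continuous (fun x => fderiv ℝ φ x v) :=
    (h.smooth.continuous_fderiv (by simp)).clm_apply continuous_const
  exact (hc.memLp_of_hasCompactSupport (h.compact.fderiv_apply ℝ v)).restrict Ω

/-- The Sobolev space `H¹(Ω)`. An element is a class `u ∈ L²(Ω)` together with its (unique) weak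
gradient `∇u ∈ L²(Ω)^d`; the norm inherited from the ambient space is
`‖u‖_{H¹(Ω)} = (‖u‖²_{L²(Ω)} + ‖∇u‖²_{L²(Ω)})^{1/2}`. -/
def H1 (Ω : Set (Euc d)) :
    Submodule ℝ (WithLp 2 (Lp ℝ 2 (volume.restrict Ω) × Lp (Euc d) 2 (volume.restrict Ω))) where
  carrier := {p | IsWeakGradient Ω p.fst p.snd}
  zero_mem' := by
    intro v φ hφ
    have h1 : ∀ᵐ x ∂(volume.restrict Ω), ((0 : Lp ℝ 2 (volume.restrict Ω)) : Euc d → ℝ) x = 0 :=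
      Lp.coeFn_zero ℝ 2 _
    have h2 : ∀ᵐ x ∂(volume.restrict Ω),
        ((0 : Lp (Euc d) 2 (volume.restrict Ω)) : Euc d → Euc d) x = 0 :=
      Lp.coeFn_zero (Euc d) 2 _
    have e1 : ∫ x in Ω, ((0 : Lp ℝ 2 (volume.restrict Ω)) : Euc d → ℝ) x * fderiv ℝ φ x v = 0 :=
      integral_eq_zero_of_ae (h1.mono fun x hx => by
        simp only [hx, zero_mul, Pi.zero_apply])
    have e2 : ∫ x in Ω, inner ℝ (((0 : Lp (Euc d) 2 (volume.restrict Ω)) : Euc d → Euc d) x) v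
        * φ x = 0 :=
      integral_eq_zero_of_ae (h2.mono fun x hx => by
        simp only [hx, inner_zero_left, zero_mul, Pi.zero_apply])
    change ∫ x in Ω, ((0 : Lp ℝ 2 (volume.restrict Ω)) : Euc d → ℝ) x * fderiv ℝ φ x v
      = - ∫ x in Ω, inner ℝ (((0 : Lp (Euc d) 2 (volume.restrict Ω)) : Euc d → Euc d) x) v * φ x
    rw [e1, e2, neg_zero]
  add_mem' := by
    intro p q hp hq v φ hφ
    have i1 : ∀ r : Lp ℝ 2 (volume.restrict Ω),
        Integrable (fun x => r x * fderiv ℝ φ x v) (volume.restrict Ω) :=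
      fun r => (Lp.memLp r).integrable_mul (hφ.memLp_fderiv v)
    have i2 : ∀ r : Lp (Euc d) 2 (volume.restrict Ω),
        Integrable (fun x => inner ℝ (r x) v * φ x) (volume.restrict Ω) :=
      fun r => ((Lp.memLp r).inner_const v).integrable_mul hφ.memLp
    have e1 : ∫ x in Ω, (p.fst + q.fst : Lp ℝ 2 (volume.restrict Ω)) x * fderiv ℝ φ x v
        = ∫ x in Ω, (p.fst x * fderiv ℝ φ x v + q.fst x * fderiv ℝ φ x v) :=
      integral_congr_ae ((Lp.coeFn_add p.fst q.fst).mono fun x hx => by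
        simp only [hx, Pi.add_apply, add_mul])
    have e2 : ∫ x in Ω, inner ℝ ((p.snd + q.snd : Lp (Euc d) 2 (volume.restrict Ω)) x) v * φ x
        = ∫ x in Ω, (inner ℝ (p.snd x) v * φ x + inner ℝ (q.snd x) v * φ x) :=
      integral_congr_ae ((Lp.coeFn_add p.snd q.snd).mono fun x hx => by
        simp only [hx, Pi.add_apply, inner_add_left, add_mul])
    have e3 := hp v φ hφ
    have e4 := hq v φ hφ
    change ∫ x in Ω, (p.fst + q.fst : Lp ℝ 2 (volume.restrict Ω)) x * fderiv ℝ φ x v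
      = - ∫ x in Ω, inner ℝ ((p.snd + q.snd : Lp (Euc d) 2 (volume.restrict Ω)) x) v * φ x
    rw [e1, e2, integral_add (i1 _) (i1 _), integral_add (i2 _) (i2 _), e3, e4]
    ring
  smul_mem' := by
    intro c p hp v φ hφ
    have e1 : ∫ x in Ω, (c • p.fst : Lp ℝ 2 (volume.restrict Ω)) x * fderiv ℝ φ x v
        = ∫ x in Ω, c * (p.fst x * fderiv ℝ φ x v) :=
      integral_congr_ae ((Lp.coeFn_smul c p.fst).mono fun x hx => by
        simp only [hx, Pi.smul_apply, smul_eq_mul, mul_assoc])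
    have e2 : ∫ x in Ω, inner ℝ ((c • p.snd : Lp (Euc d) 2 (volume.restrict Ω)) x) v * φ x
        = ∫ x in Ω, c * (inner ℝ (p.snd x) v * φ x) :=
      integral_congr_ae ((Lp.coeFn_smul c p.snd).mono fun x hx => by
        simp only [hx, Pi.smul_apply, real_inner_smul_left, mul_assoc])
    have e3 := hp v φ hφ
    change ∫ x in Ω, (c • p.fst : Lp ℝ 2 (volume.restrict Ω)) x * fderiv ℝ φ x v
      = - ∫ x in Ω, inner ℝ ((c • p.snd : Lp (Euc d) 2 (volume.restrict Ω)) x) v * φ x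
    rw [e1, e2, integral_const_mul, integral_const_mul, e3]
    ring

/-- A function representing the class `u ∈ H¹(Ω)`. -/
def H1rep {Ω : Set (Euc d)} (u : H1 Ω) : Euc d → ℝ := u.1.fst

/-- `H¹₀(Ω)`: the closure of `C^∞_c(Ω)` in `H¹(Ω)`. -/
def H10 (Ω : Set (Euc d)) : Set (H1 Ω) :=
  closure {u | ∃ φ : Euc d → ℝ, IsTestFunction Ω φ ∧ H1rep u =ᵐ[volume.restrict Ω] φ}

/-- `u ∈ H¹(Ω) ∩ C⁰(Ω̄)`, with `f` a function that is continuous on `Ω̄` and represents `u`. -/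
def IsContRep {Ω : Set (Euc d)} (u : H1 Ω) (f : Euc d → ℝ) : Prop :=
  ContinuousOn f (closure Ω) ∧ H1rep u =ᵐ[volume.restrict Ω] f

/-- The closure of `H¹(Ω) ∩ C⁰(Ω̄)` in `H¹(Ω)`. -/
def H1tilde (Ω : Set (Euc d)) : Set (H1 Ω) :=
  closure {u | ∃ f : Euc d → ℝ, IsContRep u f}

/-! ### Chords, directional traces and directional measures -/

/-- `δ_θ(x) = sup {s ≥ 0 : x + tθ ∈ Ω for all t ∈ [0, s[}`. -/
def delta (Ω : Set (Euc d)) (θ x : Euc d) : ℝ :=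
  sSup {s : ℝ | 0 ≤ s ∧ ∀ t ∈ Ico 0 s, x + t • θ ∈ Ω}

/-- `Φ_θ(x) = x + δ_θ(x) θ`. -/
def Phi (Ω : Set (Euc d)) (θ x : Euc d) : Euc d := x + delta Ω θ x • θ

/-- The hyperplane `H_θ` orthogonal to `θ`. -/
abbrev Hyp (θ : Euc d) : Submodule ℝ (Euc d) := (Submodule.span ℝ {θ})ᗮ

/-- The Lebesgue measure `λ^{d-1}` on the Euclidean space `H_θ`. -/
def hypVolume (θ : Euc d) : Measure (Hyp θ) :=
  @volume (Hyp θ) measureSpaceOfInnerProductSpace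

/-- The projection `𝒫_θ(Ω)` of `Ω` on `H_θ`. -/
def projSet (Ω : Set (Euc d)) (θ : Euc d) : Set (Hyp θ) :=
  (Hyp θ).orthogonalProjectionOnto '' Ω

/-- `ω_θ(y) = {s : sθ + y ∈ Ω}`. -/
def slice (Ω : Set (Euc d)) (θ : Euc d) (y : Hyp θ) : Set ℝ :=
  {s | s • θ + (y : Euc d) ∈ Ω}

/-- `]α, β[ ∈ 𝓘_θ(y)`: it is one of the maximal open intervals that make up `ω_θ(y)`. -/
def IsChord (Ω : Set (Euc d)) (θ : Euc d) (y : Hyp θ) (α β : ℝ) : Prop :=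
  α < β ∧ Ioo α β ⊆ slice Ω θ y ∧ α ∉ slice Ω θ y ∧ β ∉ slice Ω θ y

/-- `g` is a directional trace of `u` in the direction `θ`. Boundary functions `∂Ω → ℝ` are
written as functions on the whole space, of which only the values on `∂Ω` matter. There are a
representative `u'` of `u` and a set `A` of full measure in `𝒫_θ(Ω)` such that, for `y ∈ A`,
the function `s ↦ u'(sθ + y)` is in `H¹(ω_θ(y))` and, for each `]α, β[ ∈ 𝓘_θ(y)`, the value
at `β` of its continuous representative on `]α, β]` is `g(βθ + y)`. -/
def IsDirTrace (Ω : Set (Euc d)) (θ : Euc d) (u g : Euc d → ℝ) : Prop :=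
  ∃ u' : Euc d → ℝ, u' =ᵐ[volume.restrict Ω] u ∧
    ∃ A ⊆ projSet Ω θ, hypVolume θ (projSet Ω θ \ A) = 0 ∧
      ∀ y ∈ A, MemW (slice Ω θ y) (1 : ℝ) (fun s => u' (s • θ + (y : Euc d))) ∧
        ∀ α β, IsChord Ω θ y α β → ∃ f : ℝ → ℝ, ContinuousOn f (Ioc α β) ∧
          (∀ᵐ s ∂(volume.restrict (Ioo α β)), f s = u' (s • θ + (y : Euc d))) ∧
          g (β • θ + (y : Euc d)) = f β

/-- The directional measure `μ_θ(A) = ∫_Ω χ_A(Φ_θ(x)) dx`, a measure carried by `∂Ω`. -/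
def dirMeasure (Ω : Set (Euc d)) (θ : Euc d) : Measure (Euc d) :=
  (volume.restrict Ω).map (Phi Ω θ)

section Carried

variable {Ω : Set (Euc d)} {θ x : Euc d}

theorem delta_nonneg : 0 ≤ delta Ω θ x := Real.sSup_nonneg fun _ hs => hs.1

theorem bddAbove_delta (hb : Bornology.IsBounded Ω) (hθ : ‖θ‖ = 1) :
    BddAbove {s : ℝ | 0 ≤ s ∧ ∀ t ∈ Ico 0 s, x + t • θ ∈ Ω} := by
  obtain ⟨C, hC⟩ := Metric.isBounded_iff.1 hb
  refine ⟨max C 0, fun s hs => le_of_not_gt fun hlt => ?_⟩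
  obtain ⟨t, ht1, ht2⟩ := exists_between hlt
  have ht0 : 0 < t := lt_of_le_of_lt (le_max_right _ _) ht1
  have h1 := hs.2 t ⟨ht0.le, ht2⟩
  have h0 := hs.2 0 ⟨le_rfl, ht0.trans ht2⟩
  have h2 := hC h1 h0
  rw [dist_eq_norm] at h2
  have h3 : x + t • θ - (x + (0 : ℝ) • θ) = t • θ := by simp
  rw [h3, norm_smul, hθ, mul_one, Real.norm_of_nonneg ht0.le] at h2
  exact absurd (le_max_left C 0) (not_le.2 (ht1.trans_le h2))

theorem le_delta (hb : Bornology.IsBounded Ω) (hθ : ‖θ‖ = 1) {s : ℝ} (hs : 0 ≤ s)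
    (h : ∀ t ∈ Ico 0 s, x + t • θ ∈ Ω) : s ≤ delta Ω θ x :=
  le_csSup (bddAbove_delta hb hθ) ⟨hs, h⟩

theorem mem_of_lt_delta {t : ℝ} (ht0 : 0 ≤ t) (ht : t < delta Ω θ x) : x + t • θ ∈ Ω := by
  obtain ⟨s, hs, hts⟩ := exists_lt_of_lt_csSup
    (s := {s : ℝ | 0 ≤ s ∧ ∀ t ∈ Ico 0 s, x + t • θ ∈ Ω}) ⟨0, le_rfl, by simp⟩ ht
  exact hs.2 t ⟨ht0, hts⟩

theorem exists_uniform (hΩ : IsOpen Ω) {r : ℝ} (h : ∀ t ∈ Icc 0 r, x + t • θ ∈ Ω) :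
    ∀ᶠ y in 𝓝 x, ∀ t ∈ Icc 0 r, y + t • θ ∈ Ω := by
  have := isCompact_Icc.eventually_forall_of_forall_eventually
    (x₀ := x) (K := Icc (0 : ℝ) r) (P := fun y t => y + t • θ ∈ Ω) (by
      intro t ht
      have hc : Continuous fun z : Euc d × ℝ => z.1 + z.2 • θ := by fun_prop
      exact hc.continuousAt.eventually_mem (hΩ.mem_nhds (h t ht)))
  exact this

theorem aemeasurable_Phi (hΩ : IsOpen Ω) (hb : Bornology.IsBounded Ω) (hθ : ‖θ‖ = 1) :
    AEMeasurable (Phi Ω θ) (volume.restrict Ω) := by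
  have key : AEMeasurable (delta Ω θ) (volume.restrict Ω) := by
    refine aemeasurable_restrict_of_measurable_subtype hΩ.measurableSet
      (measurable_of_Ioi fun l => ?_)
    have ho : IsOpen {y : Euc d | l < delta Ω θ y} := by
      refine isOpen_iff_mem_nhds.2 fun y (hy : l < delta Ω θ y) => ?_
      rcases lt_or_ge l 0 with hl | hl
      · exact Filter.univ_mem' fun z => hl.trans_le delta_nonneg
      · obtain ⟨r, hr1, hr2⟩ := exists_between hy
        have hr0 : 0 ≤ r := hl.trans hr1.le
        filter_upwards [exists_uniform (θ := θ) (r := r) hΩ fun t ht =>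
          mem_of_lt_delta ht.1 (ht.2.trans_lt hr2)] with z hz
        exact hr1.trans_le (le_delta hb hθ hr0 fun t ht => hz t ⟨ht.1, ht.2.le⟩)
    exact (ho.preimage continuous_subtype_val).measurableSet
  exact aemeasurable_id.add (key.smul_const θ)

theorem Phi_mem_frontier (hΩ : IsOpen Ω) (hb : Bornology.IsBounded Ω) (hθ : ‖θ‖ = 1)
    (hx : x ∈ Ω) : Phi Ω θ x ∈ frontier Ω := by
  have hc : Continuous fun t : ℝ => x + t • θ := by fun_prop
  have hnot : Phi Ω θ x ∉ Ω := by
    intro hmem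
    have hU : ∀ᶠ t in 𝓝 (delta Ω θ x), x + t • θ ∈ Ω :=
      hc.continuousAt.eventually_mem (hΩ.mem_nhds hmem)
    obtain ⟨ε, hε, hball⟩ := Metric.eventually_nhds_iff.1 hU
    have : delta Ω θ x + ε ≤ delta Ω θ x :=
      le_delta hb hθ (add_nonneg delta_nonneg hε.le) fun t ht => by
        rcases lt_or_ge t (delta Ω θ x) with h | h
        · exact mem_of_lt_delta ht.1 h
        · refine hball ?_
          rw [Real.dist_eq, abs_of_nonneg (sub_nonneg.2 h)]
          linarith [ht.2]
    linarith
  have hpos : delta Ω θ x ≠ 0 := by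
    intro h0
    apply hnot
    simpa [Phi, h0] using hx
  have hlt : 0 < delta Ω θ x := lt_of_le_of_ne delta_nonneg (Ne.symm hpos)
  rw [hΩ.frontier_eq]
  refine ⟨?_, hnot⟩
  have hcl : delta Ω θ x ∈ closure (Ico 0 (delta Ω θ x)) := by
    rw [closure_Ico hlt.ne]
    exact ⟨hlt.le, le_rfl⟩
  exact closure_mono (by rintro _ ⟨t, ht, rfl⟩; exact mem_of_lt_delta ht.1 ht.2)
    (image_closure_subset_closure_image hc (mem_image_of_mem _ hcl))

/-- `μ_θ` is carried by `∂Ω`. -/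
theorem dirMeasure_compl_frontier (hΩ : IsOpen Ω) (hb : Bornology.IsBounded Ω) (hθ : ‖θ‖ = 1) :
    dirMeasure Ω θ (frontier Ω)ᶜ = 0 := by
  rw [dirMeasure, Measure.map_apply_of_aemeasurable (aemeasurable_Phi hΩ hb hθ)
    isClosed_frontier.measurableSet.compl, Measure.restrict_apply' hΩ.measurableSet]
  convert measure_empty (μ := (volume : Measure (Euc d)))
  ext x
  simp only [mem_inter_iff, mem_preimage, mem_compl_iff, mem_empty_iff_false, iff_false, not_and]
  exact fun h hx => h (Phi_mem_frontier hΩ hb hθ hx)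

end Carried

/-! ### The space `L²(∂Ω, (μ_θ)_θ)` -/

/-- The unit sphere. -/
abbrev Sph (d : ℕ) : Set (Euc d) := Metric.sphere 0 1

/-- `g ∈ 𝓛²(∂Ω, (μ_θ)_θ)`: the function `g` is in `𝓛²(∂Ω, μ_θ)` for every `θ` (up to
modification on a `μ_θ`-negligible set), with a bound independent of `θ`. -/
def MemL2Bdry (Ω : Set (Euc d)) (g : Euc d → ℝ) : Prop :=
  ∃ M : ℝ, ∀ θ ∈ Sph d,
    MemLp g 2 (dirMeasure Ω θ) ∧ ∫ z, g z ^ 2 ∂(dirMeasure Ω θ) ≤ M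

/-- `g` and `h` define the same element of `L²(∂Ω, (μ_θ)_θ)`. -/
def BdryEquiv (Ω : Set (Euc d)) (g h : Euc d → ℝ) : Prop :=
  ∀ θ ∈ Sph d, g =ᵐ[dirMeasure Ω θ] h

/-- The norm of `L²(∂Ω, (μ_θ)_θ)`, with values in `[0, ∞]`. -/
def bdryNorm (Ω : Set (Euc d)) (g : Euc d → ℝ) : ℝ≥0∞ :=
  ⨆ θ ∈ Sph d, eLpNorm g 2 (dirMeasure Ω θ)

/-! ### Omnidirectional traces -/

/-- `g` is (a representative of) the omnidirectional trace of `u ∈ H¹(Ω)`: it is in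
`𝓛²(∂Ω, (μ_θ)_θ)`, and for every `θ` it equals `μ_θ`-a.e. the directional trace of `u`. -/
def IsOmniTrace {Ω : Set (Euc d)} (u : H1 Ω) (g : Euc d → ℝ) : Prop :=
  MemL2Bdry Ω g ∧
    ∀ θ ∈ Sph d, ∃ h : Euc d → ℝ, IsDirTrace Ω θ (H1rep u) h ∧ h =ᵐ[dirMeasure Ω θ] g

/-- `H¹_tr(Ω)`: the elements of `H¹(Ω)` that have an omnidirectional trace. -/
def H1tr (Ω : Set (Euc d)) : Set (H1 Ω) := {u | ∃ g, IsOmniTrace u g}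

/-- `H¹_{tr,0}(Ω)`: the elements of `H¹_tr(Ω)` with `tr(u) = 0` in `L²(∂Ω, (μ_θ)_θ)`. -/
def H1tr0 (Ω : Set (Euc d)) : Set (H1 Ω) := {u | ∃ g, IsOmniTrace u g ∧ BdryEquiv Ω g 0}

end OmniTrace

end

open OmniTrace

open MeasureTheory Set Filter Topology
open scoped ENNReal ContDiff

noncomputable section

namespace OmniTrace

section

variable {d : ℕ} {θ : Euc d} {Ω : Set (Euc d)}

/-! ### Fubini along the lines of direction `θ` -/

/-! Fubini in a fixed direction `θ` reduces everything to one-dimensional calculus. On almost every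
line, `u ∈ H¹(Ω)` has a weak derivative given by `∇u · θ`, so on each chord `(α, β)` it is a.e. a
primitive and has a value at `β` (`ae_isWeakDirDeriv_slice`, `exists_eq_primitive`). Averaging the
formula `u(β) = u(s) + ∫_s^β u'` over the chord gives `|u(β)|² (β - α) ≤ C ∫ (|u|² + |∇u|²)`
(`IsGoodLine.trace_le`). Since `Φ_θ` sends the whole chord to its right end, `μ_θ` weighs that end
by exactly `β - α`; integrating over the lines yields the trace inequality `‖tr u‖_{L²(μ_θ)} ≤
C^{1/2} ‖u‖_{H¹}` (`HasLineTraces.eLpNorm_le`). The constant depends only on the size of `Ω`, not on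
`θ` and not on the regularity of `∂Ω`. Uniqueness of the trace and convergence of boundary values
are consequences.

For existence on `H̃¹` (`exists_isOmniTrace`), take continuous functions that converge to `u` so
fast that the squared errors are summable, and let `g` be the pointwise limit of their boundary
values. For each `θ`, on almost every line the errors have summable energy, so the chord inequality
forces convergence at every right end. One function `g` thus serves all directions. If the
approximants are test functions, their boundary values vanish, hence so does the trace: this is the
first inclusion.

For the second inclusion, a zero trace in the directions `θ` and `-θ` means that `u` vanishes at
both ends of almost every chord. Integrating by parts on chords then leaves no boundary term, so the
extensions by zero of `u` and `∇u` satisfy the weak derivative identity on the whole space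
(`integral_mul_fderiv_of_mem_H1tr0`). Mollifying that extension gives continuous functions that
approximate `u` in `H¹(Ω)`. -/

instance (θ : Euc d) : SFinite (hypVolume θ) := by
  unfold hypVolume; infer_instance

/-- The parametrisation `(y, s) ↦ sθ + y` of the space by `H_θ × ℝ`. -/
def lineMap (θ : Euc d) (p : Hyp θ × ℝ) : Euc d := p.2 • θ + (p.1 : Euc d)

theorem inner_hyp (y : Hyp θ) : inner ℝ θ (y : Euc d) = 0 :=
  Submodule.mem_orthogonal_singleton_iff_inner_right.1 y.2

theorem continuous_lineMap (θ : Euc d) : Continuous (lineMap θ) := by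
  unfold lineMap; fun_prop

theorem continuous_line (θ : Euc d) (y : Hyp θ) : Continuous fun s : ℝ => s • θ + (y : Euc d) := by
  fun_prop

/-- The parametrisation `lineMap` as a linear isometry. -/
def lineIsometry (hθ : ‖θ‖ = 1) : WithLp 2 (Hyp θ × ℝ) →ₗᵢ[ℝ] Euc d where
  toFun p := p.snd • θ + (p.fst : Euc d)
  map_add' p q := by simp [add_smul]; abel
  map_smul' c p := by simp [mul_smul]
  norm_map' p := by
    have h : ‖p.snd • θ + (p.fst : Euc d)‖ ^ 2 = ‖p‖ ^ 2 := by
      rw [WithLp.prod_norm_sq_eq_of_L2, norm_add_sq_real, real_inner_smul_left, inner_hyp,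
        norm_smul, hθ]
      simp [add_comm]
    exact (sq_eq_sq₀ (norm_nonneg _) (norm_nonneg _)).1 h

theorem surjective_lineIsometry (hθ : ‖θ‖ = 1) : Function.Surjective (lineIsometry hθ) := by
  intro x
  have hx : x - inner ℝ θ x • θ ∈ Hyp θ := by
    rw [Submodule.mem_orthogonal_singleton_iff_inner_right, inner_sub_right, real_inner_smul_right,
      real_inner_self_eq_norm_sq, hθ]
    ring
  exact ⟨WithLp.toLp 2 (⟨_, hx⟩, inner ℝ θ x), by simp [lineIsometry]⟩

/-- Since `θ` is a unit vector orthogonal to `H_θ`, the parametrisation is a surjective isometry of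
the Euclidean product, and isometries preserve volume. -/
theorem measurePreserving_lineMap (hθ : ‖θ‖ = 1) :
    MeasurePreserving (lineMap θ) ((hypVolume θ).prod volume) volume := by
  let _ : MeasureSpace (Hyp θ) := measureSpaceOfInnerProductSpace
  have h1 := WithLp.volume_preserving_toLp (Hyp θ) ℝ
  have h2 := (LinearIsometryEquiv.ofSurjective _ (surjective_lineIsometry hθ)).measurePreserving
  exact h2.comp h1

theorem exists_line (hθ : ‖θ‖ = 1) (x : Euc d) : ∃ p, lineMap θ p = x := by
  obtain ⟨p, hp⟩ := surjective_lineIsometry hθ x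
  exact ⟨(p.fst, p.snd), hp⟩

theorem isOpen_slice (hΩ : IsOpen Ω) (y : Hyp θ) : IsOpen (slice Ω θ y) :=
  hΩ.preimage (continuous_line θ y)

theorem proj_line (hθ : ‖θ‖ = 1) (y : Hyp θ) (s : ℝ) :
    (Hyp θ).orthogonalProjectionOnto (s • θ + (y : Euc d)) = y ∧
      inner ℝ θ (s • θ + (y : Euc d)) = s := by
  constructor
  · have h1 : (Hyp θ).orthogonalProjectionOnto θ = 0 := by
      rw [Submodule.orthogonalProjectionOnto_eq_zero_iff, Submodule.mem_orthogonal]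
      intro v hv
      rw [real_inner_comm]
      exact Submodule.mem_orthogonal_singleton_iff_inner_right.1 hv
    simp [h1]
  · rw [inner_add_right, real_inner_smul_right, real_inner_self_eq_norm_sq, hθ, inner_hyp]
    ring

theorem mem_projSet_of_mem_slice (hθ : ‖θ‖ = 1) {y : Hyp θ} {s : ℝ} (h : s ∈ slice Ω θ y) :
    y ∈ projSet Ω θ :=
  ⟨_, h, (proj_line hθ y s).1⟩

theorem lintegral_lines (hθ : ‖θ‖ = 1) (hΩ : IsOpen Ω) {F : Euc d → ℝ≥0∞}
    (hF : AEMeasurable F (volume.restrict Ω)) :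
    ∫⁻ x in Ω, F x = ∫⁻ y : Hyp θ, (∫⁻ s in slice Ω θ y, F (s • θ + (y : Euc d))) ∂(hypVolume θ) := by
  have hm := measurePreserving_lineMap hθ
  have hF' : AEMeasurable (Ω.indicator F) volume :=
    (aemeasurable_indicator_iff hΩ.measurableSet).2 hF
  rw [← lintegral_indicator hΩ.measurableSet, ← hm.map_eq,
    lintegral_map' (by rwa [hm.map_eq]) hm.measurable.aemeasurable]
  refine (lintegral_prod _
    (hF'.comp_quasiMeasurePreserving hm.quasiMeasurePreserving)).trans (lintegral_congr fun y => ?_)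
  rw [← lintegral_indicator (isOpen_slice hΩ y).measurableSet]
  rfl

theorem aemeasurable_lintegral_lines (hθ : ‖θ‖ = 1) (hΩ : IsOpen Ω) {F : Euc d → ℝ≥0∞}
    (hF : AEMeasurable F (volume.restrict Ω)) :
    AEMeasurable (fun y : Hyp θ => ∫⁻ s in slice Ω θ y, F (s • θ + (y : Euc d)))
      (hypVolume θ) := by
  have hm := measurePreserving_lineMap hθ
  have hF' : AEMeasurable (Ω.indicator F) volume :=
    (aemeasurable_indicator_iff hΩ.measurableSet).2 hF
  refine (hF'.comp_quasiMeasurePreserving hm.quasiMeasurePreserving).lintegral_prod_right'.congr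
    (Eventually.of_forall fun y => ?_)
  simp only
  rw [← lintegral_indicator (isOpen_slice hΩ y).measurableSet]
  rfl

theorem ae_lines (hθ : ‖θ‖ = 1) (hΩ : IsOpen Ω) {P : Euc d → Prop}
    (h : ∀ᵐ x ∂(volume.restrict Ω), P x) :
    ∀ᵐ y : Hyp θ ∂(hypVolume θ), ∀ᵐ s ∂(volume.restrict (slice Ω θ y)), P (s • θ + (y : Euc d)) := by
  have hm := measurePreserving_lineMap hθ
  rw [ae_restrict_iff' hΩ.measurableSet] at h
  have h1 := Measure.ae_ae_of_ae_prod (hm.quasiMeasurePreserving.ae h)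
  filter_upwards [h1] with y hy
  rw [ae_restrict_iff' (isOpen_slice hΩ y).measurableSet]
  exact hy

theorem memLp_lines (hθ : ‖θ‖ = 1) (hΩ : IsOpen Ω) {F : Type*} [NormedAddCommGroup F]
    {f : Euc d → F} (hf : MemLp f 2 (volume.restrict Ω)) :
    ∀ᵐ y : Hyp θ ∂(hypVolume θ),
      MemLp (fun s : ℝ => f (s • θ + (y : Euc d))) 2 (volume.restrict (slice Ω θ y)) := by
  have hm := measurePreserving_lineMap hθ
  have h1 : MemLp (Ω.indicator f) 2 volume := (memLp_indicator_iff_restrict hΩ.measurableSet).2 hf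
  have h2 : MemLp (Ω.indicator f ∘ lineMap θ) 2 ((hypVolume θ).prod volume) :=
    h1.comp_measurePreserving hm
  have h3 := ((memLp_two_iff_integrable_sq_norm h2.1).1 h2).prod_right_ae
  have h4 := h2.1.prodMk_left
  filter_upwards [h3, h4] with y hy3 hy4
  have h5 : MemLp (fun s => (Ω.indicator f ∘ lineMap θ) (y, s)) 2 volume :=
    (memLp_two_iff_integrable_sq_norm hy4).2 hy3
  rw [← memLp_indicator_iff_restrict (isOpen_slice hΩ y).measurableSet]
  exact h5

theorem integral_lines (hθ : ‖θ‖ = 1) (hΩ : IsOpen Ω) {f : Euc d → ℝ}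
    (hf : Integrable f (volume.restrict Ω)) :
    Integrable (fun y : Hyp θ => ∫ s in slice Ω θ y, f (s • θ + (y : Euc d))) (hypVolume θ) ∧
    ∫ x in Ω, f x = ∫ y : Hyp θ, (∫ s in slice Ω θ y, f (s • θ + (y : Euc d))) ∂(hypVolume θ) := by
  have hm := measurePreserving_lineMap hθ
  have h1 : Integrable (Ω.indicator f) volume := (integrable_indicator_iff hΩ.measurableSet).2 hf
  have h2 : Integrable (Ω.indicator f ∘ lineMap θ) ((hypVolume θ).prod volume) :=
    hm.integrable_comp_of_integrable h1
  have e : ∀ y : Hyp θ, ∫ s, (Ω.indicator f ∘ lineMap θ) (y, s)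
      = ∫ s in slice Ω θ y, f (s • θ + (y : Euc d)) := by
    intro y
    rw [← integral_indicator (isOpen_slice hΩ y).measurableSet]
    rfl
  refine ⟨?_, ?_⟩
  · simpa only [e] using h2.integral_prod_left
  · rw [← integral_indicator hΩ.measurableSet, ← hm.map_eq,
      integral_map hm.measurable.aemeasurable (by rw [hm.map_eq]; exact h1.1)]
    have := integral_prod _ h2
    simp only [e] at this
    exact this

end

section

/-! ### Weak derivatives on an interval -/

theorem IsWeakDirDeriv.mono {E : Type*} [NormedAddCommGroup E] [NormedSpace ℝ E] [MeasureSpace E]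
    [OpensMeasurableSpace E] {Ω I : Set E} {v : E} {u w : E → ℝ} (h : IsWeakDirDeriv Ω v u w)
    (hΩ : IsOpen Ω) (hI : I ⊆ Ω) : IsWeakDirDeriv I v u w := by
  intro φ hφ
  have h1 := h φ ⟨hφ.smooth, hφ.compact, hφ.supp.trans hI⟩
  rw [setIntegral_eq_of_subset_of_forall_sdiff_eq_zero hΩ.measurableSet hI,
    setIntegral_eq_of_subset_of_forall_sdiff_eq_zero hΩ.measurableSet hI] at h1
  · exact h1
  · intro x hx
    rw [image_eq_zero_of_notMem_tsupport fun h' => hx.2 (hφ.supp h'), mul_zero]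
  · intro x hx
    rw [image_eq_zero_of_notMem_tsupport (f := fderiv ℝ φ)
      fun h' => hx.2 (hφ.supp (tsupport_fderiv_subset ℝ h'))]
    simp

theorem IsTestFunction.exists_Icc {α β : ℝ} (hαβ : α < β) {φ : ℝ → ℝ}
    (hφ : IsTestFunction (Ioo α β) φ) :
    ∃ a b, α < a ∧ a < b ∧ b < β ∧ ∀ s, s ∉ Icc a b → φ s = 0 := by
  obtain ⟨m, hm1, hm2⟩ := exists_between hαβ
  obtain ⟨m', hm1', hm2'⟩ := exists_between hm2
  -- The two extra points make the compact set nonempty and force `a < b`, even when `φ = 0`.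
  have hK : IsCompact (tsupport φ ∪ {m, m'}) := hφ.compact.union (Set.toFinite _).isCompact
  have hKs : tsupport φ ∪ {m, m'} ⊆ Ioo α β := by
    refine union_subset hφ.supp ?_
    rintro x (rfl | rfl)
    exacts [⟨hm1, hm2⟩, ⟨hm1.trans hm1', hm2'⟩]
  have hne : (tsupport φ ∪ {m, m'}).Nonempty := ⟨m, by simp⟩
  refine ⟨_, _, (hKs (hK.sInf_mem hne)).1, ?_, (hKs (hK.sSup_mem hne)).2, fun s hs => ?_⟩
  · exact (csInf_le hK.bddBelow (by simp)).trans_lt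
      (hm1'.trans_le (le_csSup hK.bddAbove (by simp)))
  · refine image_eq_zero_of_notMem_tsupport fun h => hs ⟨?_, ?_⟩
    · exact csInf_le hK.bddBelow (Or.inl h)
    · exact le_csSup hK.bddAbove (Or.inl h)

theorem hasDerivAt_primitive {φ : ℝ → ℝ} (hφ : Continuous φ) (α s : ℝ) :
    HasDerivAt (fun s => ∫ t in α..s, φ t) (φ s) s :=
  intervalIntegral.integral_hasDerivAt_right (hφ.intervalIntegrable _ _)
    hφ.stronglyMeasurable.stronglyMeasurableAtFilter hφ.continuousAt

/-- The primitive of a test function of zero integral is a test function. -/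
theorem IsTestFunction.primitive {α β : ℝ} (hαβ : α < β) {φ : ℝ → ℝ}
    (hφ : IsTestFunction (Ioo α β) φ) (h0 : ∫ s, φ s = 0) :
    IsTestFunction (Ioo α β) (fun s => ∫ t in α..s, φ t) := by
  obtain ⟨a, b, ha, hab, hb, hz⟩ := hφ.exists_Icc hαβ
  have hc := hφ.smooth.continuous
  have hd := hasDerivAt_primitive hc α
  have hz' : ∀ s, s ∉ Icc a b → ∫ t in α..s, φ t = 0 := by
    intro s hs
    rw [mem_Icc, not_and_or, not_le, not_le] at hs
    -- This includes `s < α`, where the oriented integral runs backwards; the single point `a`, at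
    -- which nothing is known about `φ`, is discarded as a null set.
    have hleft : ∀ s, s ≤ a → ∫ t in α..s, φ t = 0 := by
      intro s hs
      refine (intervalIntegral.integral_congr_ae (g := fun _ => 0) ?_).trans (by simp)
      have : ∀ᵐ x : ℝ, x ≠ a := by simp [ae_iff, measure_singleton]
      filter_upwards [this] with t ht h1
      refine hz t fun h2 => ?_
      have h3 : t ≤ max α s := h1.2
      rcases le_max_iff.1 h3 with h4 | h4
      · linarith [h2.1]
      · exact ht (le_antisymm (h4.trans hs) h2.1)
    rcases hs with hs | hs
    · exact hleft s hs.le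
    -- Beyond `b` the primitive has collected the whole integral of `φ`, which is zero.
    · have h1 : ∫ t, φ t = ∫ t in a..s, φ t := by
        rw [intervalIntegral.integral_of_le (hab.le.trans hs.le), ← integral_Icc_eq_integral_Ioc]
        refine (setIntegral_eq_integral_of_forall_compl_eq_zero fun t ht => hz t fun h => ht ?_).symm
        exact ⟨h.1, h.2.trans hs.le⟩
      rw [← intervalIntegral.integral_add_adjacent_intervals (hc.intervalIntegrable α a)
        (hc.intervalIntegrable a s), ← h1, h0, hleft a le_rfl, add_zero]
  have hsub : tsupport (fun s => ∫ t in α..s, φ t) ⊆ Icc a b :=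
    closure_minimal (fun s hs => by_contra fun h => hs (hz' s h)) isClosed_Icc
  refine ⟨contDiff_infty_iff_deriv.2 ⟨fun s => (hd s).differentiableAt, ?_⟩,
    isCompact_Icc.of_isClosed_subset (isClosed_tsupport _) hsub,
    hsub.trans fun s hs => ⟨ha.trans_le hs.1, hs.2.trans_lt hb⟩⟩
  rw [funext fun s => (hd s).deriv]
  exact hφ.smooth

theorem IsTestFunction.integrable {E : Type*} [NormedAddCommGroup E] [NormedSpace ℝ E]
    [MeasurableSpace E] [BorelSpace E] {μ : Measure E} [IsFiniteMeasureOnCompacts μ]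
    {Ω : Set E} {φ : E → ℝ} (hφ : IsTestFunction Ω φ) : Integrable φ μ :=
  hφ.smooth.continuous.integrable_of_hasCompactSupport hφ.compact

theorem exists_test_integral_eq_one {α β : ℝ} (hαβ : α < β) :
    ∃ ρ : ℝ → ℝ, IsTestFunction (Ioo α β) ρ ∧ ∫ s, ρ s = 1 := by
  let B : ContDiffBump ((α + β) / 2) :=
    ⟨(β - α) / 8, (β - α) / 4, by linarith, by linarith⟩
  refine ⟨B.normed volume, ⟨B.contDiff_normed, B.hasCompactSupport_normed, ?_⟩, B.integral_normed⟩
  rw [B.tsupport_normed_eq, Real.closedBall_eq_Icc]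
  intro s hs
  simp only [B] at hs
  exact ⟨by linarith [hs.1], by linarith [hs.2]⟩

theorem IsTestFunction.linear {E : Type*} [NormedAddCommGroup E] [NormedSpace ℝ E] {Ω : Set E}
    {φ ψ : E → ℝ} (hφ : IsTestFunction Ω φ) (hψ : IsTestFunction Ω ψ) (c : ℝ) :
    IsTestFunction Ω (fun s => φ s - c * ψ s) := by
  have hψ' : tsupport (fun s => c * ψ s) ⊆ tsupport ψ := tsupport_mul_subset_right
  refine ⟨hφ.smooth.sub (contDiff_const.mul hψ.smooth),
    hφ.compact.sub (hψ.compact.mono' (subset_closure.trans hψ')), ?_⟩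
  exact (tsupport_sub _ _).trans (union_subset hφ.supp (hψ'.trans hψ.supp))

theorem integrableOn_mul_test {E : Type*} [NormedAddCommGroup E] [NormedSpace ℝ E]
    [MeasurableSpace E] [BorelSpace E] {μ : Measure E} {v φ : E → ℝ}
    (hv : Integrable v μ) (hφ : Continuous φ) (hc : HasCompactSupport φ) :
    Integrable (fun s => v s * φ s) μ := by
  obtain ⟨C, hC⟩ := hc.exists_bound_of_continuous hφ
  exact hv.mul_bdd hφ.aestronglyMeasurable (Eventually.of_forall hC)

/-- **du Bois-Reymond lemma**. -/
theorem exists_const_of_weakDeriv_eq_zero {α β : ℝ} (hαβ : α < β) {v : ℝ → ℝ}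
    (hv : IntegrableOn v (Ioo α β))
    (h : ∀ ψ, IsTestFunction (Ioo α β) ψ → ∫ s in Ioo α β, v s * deriv ψ s = 0) :
    ∃ c, ∀ᵐ s ∂(volume.restrict (Ioo α β)), v s = c := by
  obtain ⟨ρ, hρ, hρ1⟩ := exists_test_integral_eq_one hαβ
  set c := ∫ s in Ioo α β, v s * ρ s with hcdef
  refine ⟨c, ?_⟩
  have hvc : IntegrableOn (fun s => v s - c) (Ioo α β) :=
    hv.sub (integrableOn_const (by simp))
  have key := isOpen_Ioo.ae_eq_zero_of_integral_contDiff_smul_eq_zero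
    (hvc.locallyIntegrableOn) ?_
  · rw [ae_restrict_iff' measurableSet_Ioo]
    filter_upwards [key] with s hs hs'
    linarith [hs hs']
  intro φ hφ1 hφ2 hφ3
  have hφ : IsTestFunction (Ioo α β) φ := ⟨hφ1, hφ2, hφ3⟩
  -- Any test function `φ` is corrected by `m ρ` to have zero integral, hence a primitive that is
  -- again a test function. The hypothesis then reads `∫ v φ = m ∫ v ρ = c ∫ φ`.
  set m := ∫ s, φ s with hm
  have hψ := hφ.linear hρ m
  have hψ0 : ∫ s, (φ s - m * ρ s) = 0 := by
    rw [integral_sub hφ.integrable (hρ.integrable.const_mul _), integral_const_mul, hρ1]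
    ring
  have h1 := h _ (hψ.primitive hαβ hψ0)
  rw [funext fun s => (hasDerivAt_primitive hψ.smooth.continuous α s).deriv] at h1
  have iφ := integrableOn_mul_test hv hφ.smooth.continuous hφ.compact
  have iρ := integrableOn_mul_test hv hρ.smooth.continuous hρ.compact
  have h2 : ∫ s in Ioo α β, v s * (φ s - m * ρ s)
      = ∫ s in Ioo α β, (v s * φ s - m * (v s * ρ s)) := by
    congr 1; ext s; ring
  rw [h2, integral_sub iφ (iρ.const_mul _), integral_const_mul, ← hcdef] at h1
  have h3 : ∫ s, φ s • (v s - c) = ∫ s in Ioo α β, φ s • (v s - c) := by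
    refine (setIntegral_eq_integral_of_forall_compl_eq_zero fun s hs => ?_).symm
    rw [image_eq_zero_of_notMem_tsupport fun h' => hs (hφ3 h'), zero_smul]
  have h4 : ∫ s in Ioo α β, φ s = m :=
    setIntegral_eq_integral_of_forall_compl_eq_zero fun s hs =>
      image_eq_zero_of_notMem_tsupport fun h' => hs (hφ3 h')
  have h5 : ∫ s in Ioo α β, φ s • (v s - c) = ∫ s in Ioo α β, (v s * φ s - c * φ s) := by
    congr 1; ext s; simp only [smul_eq_mul]; ring
  rw [h3, h5, integral_sub iφ (hφ.integrable.const_mul _), integral_const_mul, h4]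
  linarith

theorem intervalIntegrable_of_Ioo {α β : ℝ} (hαβ : α ≤ β) {w : ℝ → ℝ}
    (hw : IntegrableOn w (Ioo α β)) : IntervalIntegrable w volume α β :=
  (intervalIntegrable_iff_integrableOn_Ioo_of_le hαβ).2 hw

theorem intervalIntegral_eq_Ioo {α β : ℝ} (hαβ : α ≤ β) (w : ℝ → ℝ) :
    ∫ s in α..β, w s = ∫ s in Ioo α β, w s := by
  rw [intervalIntegral.integral_of_le hαβ, integral_Ioc_eq_integral_Ioo]

theorem continuousOn_primitive {α β : ℝ} (hαβ : α ≤ β) {w : ℝ → ℝ}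
    (hw : IntegrableOn w (Ioo α β)) (c : ℝ) :
    ContinuousOn (fun s => c + ∫ t in α..s, w t) (Icc α β) := by
  have := (intervalIntegrable_of_Ioo hαβ hw).absolutelyContinuousOnInterval_intervalIntegral
    (c := α) (by simp)
  rw [← uIcc_of_le hαβ]
  exact continuousOn_const.add this.continuousOn

/-- Integration by parts of a primitive against a smooth function. -/
theorem integral_primitive_mul_deriv {α β : ℝ} (hαβ : α ≤ β) {w : ℝ → ℝ}
    (hw : IntegrableOn w (Ioo α β)) (c : ℝ) {φ : ℝ → ℝ} (hφ : ContDiff ℝ ∞ φ) :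
    ∫ s in Ioo α β, (c + ∫ t in α..s, w t) * deriv φ s
      = (c + ∫ t in α..β, w t) * φ β - c * φ α - ∫ s in Ioo α β, w s * φ s := by
  have hi := intervalIntegrable_of_Ioo hαβ hw
  have h1 : AbsolutelyContinuousOnInterval (fun s => c + ∫ t in α..s, w t) α β := by
    have hc : AbsolutelyContinuousOnInterval (fun _ : ℝ => c) α β :=
      (contDiff_const.contDiffOn (𝕜 := ℝ)).absolutelyContinuousOnInterval
    exact hc.add (hi.absolutelyContinuousOnInterval_intervalIntegral (c := α) (by simp))
  have h2 : AbsolutelyContinuousOnInterval φ α β :=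
    ((hφ.of_le (by simp)).contDiffOn).absolutelyContinuousOnInterval
  have h3 := h1.integral_mul_deriv_eq_deriv_mul h2
  have h4 : ∫ s in α..β, deriv (fun s => c + ∫ t in α..s, w t) s * φ s
      = ∫ s in α..β, w s * φ s := by
    refine intervalIntegral.integral_congr_ae ?_
    filter_upwards [hi.ae_hasDerivAt_integral] with s hs hs'
    rw [((hs (uIoc_subset_uIcc hs') α (by simp)).const_add c).deriv]
  rw [h4, intervalIntegral_eq_Ioo hαβ, intervalIntegral_eq_Ioo hαβ (fun s => w s * φ s)] at h3
  simpa using h3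

/-- A function with an integrable weak derivative is a.e. equal to a primitive of it. -/
theorem exists_eq_primitive {α β : ℝ} (hαβ : α < β) {u w : ℝ → ℝ}
    (hu : IntegrableOn u (Ioo α β)) (hw : IntegrableOn w (Ioo α β))
    (h : IsWeakDirDeriv (Ioo α β) (1 : ℝ) u w) :
    ∃ c, ∀ᵐ s ∂(volume.restrict (Ioo α β)), u s = c + ∫ t in α..s, w t := by
  have hW : IntegrableOn (fun s => 0 + ∫ t in α..s, w t) (Ioo α β) :=
    ((continuousOn_primitive hαβ.le hw 0).integrableOn_Icc).mono_set Ioo_subset_Icc_self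
  -- The primitive of `w` also has weak derivative `w`, so its difference with `u` has weak
  -- derivative zero.
  obtain ⟨c, hc⟩ := exists_const_of_weakDeriv_eq_zero hαβ (hu.sub hW) (by
    intro ψ hψ
    have h1 := h ψ hψ
    simp only [fderiv_apply_one_eq_deriv] at h1
    have hcd : Continuous (deriv ψ) := hψ.smooth.continuous_deriv (by simp)
    have h2 := integral_primitive_mul_deriv hαβ.le hw 0 hψ.smooth
    have ha : ψ α = 0 := image_eq_zero_of_notMem_tsupport fun h' => lt_irrefl _ (hψ.supp h').1
    have hb : ψ β = 0 := image_eq_zero_of_notMem_tsupport fun h' => lt_irrefl _ (hψ.supp h').2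
    have e : ∫ s in Ioo α β, (u - fun s => 0 + ∫ t in α..s, w t) s * deriv ψ s
        = ∫ s in Ioo α β, (u s * deriv ψ s - (0 + ∫ t in α..s, w t) * deriv ψ s) := by
      congr 1; ext s; simp only [Pi.sub_apply]; ring
    rw [e, integral_sub (integrableOn_mul_test hu hcd hψ.compact.deriv)
      (integrableOn_mul_test hW hcd hψ.compact.deriv), h1, h2, ha, hb]
    ring)
  refine ⟨c, hc.mono fun s hs => ?_⟩
  simp only [Pi.sub_apply] at hs
  linarith

end

section

variable {d : ℕ} {θ : Euc d} {Ω : Set (Euc d)} {y : Hyp θ} {α β α' β' s : ℝ}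

/-! ### Chords -/

theorem slice_subset_Icc (hθ : ‖θ‖ = 1) {R : ℝ} (hR : Ω ⊆ Metric.closedBall 0 R) (y : Hyp θ) :
    slice Ω θ y ⊆ Icc (-R) R := by
  intro s hs
  have h1 : ‖s • θ + (y : Euc d)‖ ≤ R := by simpa using hR hs
  have h2 := (proj_line hθ y s).2
  have h3 := abs_real_inner_le_norm θ (s • θ + (y : Euc d))
  rw [h2, hθ, one_mul] at h3
  exact abs_le.1 (h3.trans h1)

theorem IsChord.subset_Icc (hθ : ‖θ‖ = 1) {R : ℝ} (hR : Ω ⊆ Metric.closedBall 0 R)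
    (h : IsChord Ω θ y α β) : Icc α β ⊆ Icc (-R) R := by
  rw [← closure_Ioo h.1.ne]
  exact closure_minimal (h.2.1.trans (slice_subset_Icc hθ hR y)) isClosed_Icc

/-- The complement of the slice is closed and, `Ω` being bounded, has points on both sides of `s`;
the nearest ones are the ends of the chord. -/
theorem exists_isChord (hθ : ‖θ‖ = 1) (hΩ : IsOpen Ω) (hb : Bornology.IsBounded Ω)
    (hs : s ∈ slice Ω θ y) : ∃ α β, IsChord Ω θ y α β ∧ s ∈ Ioo α β := by
  obtain ⟨R, hR⟩ := hb.subset_closedBall 0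
  have hsub := slice_subset_Icc hθ hR y
  have hcl : IsClosed (slice Ω θ y)ᶜ := (isOpen_slice hΩ y).isClosed_compl
  have hout : ∀ t, t ∉ Icc (-R) R → t ∈ (slice Ω θ y)ᶜ := fun t ht h => ht (hsub h)
  have hsR := hsub hs
  have c1 : IsClosed ((slice Ω θ y)ᶜ ∩ Ici s) := hcl.inter isClosed_Ici
  have c2 : IsClosed ((slice Ω θ y)ᶜ ∩ Iic s) := hcl.inter isClosed_Iic
  have n1 : ((slice Ω θ y)ᶜ ∩ Ici s).Nonempty :=
    ⟨R + 1, hout _ fun h => by linarith [h.2], by simp only [mem_Ici]; linarith [hsR.2]⟩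
  have n2 : ((slice Ω θ y)ᶜ ∩ Iic s).Nonempty :=
    ⟨-R - 1, hout _ fun h => by linarith [h.1], by simp only [mem_Iic]; linarith [hsR.1]⟩
  have b1 : BddBelow ((slice Ω θ y)ᶜ ∩ Ici s) := ⟨s, fun t ht => ht.2⟩
  have b2 : BddAbove ((slice Ω θ y)ᶜ ∩ Iic s) := ⟨s, fun t ht => ht.2⟩
  have m1 := c1.csInf_mem n1 b1
  have m2 := c2.csSup_mem n2 b2
  have l1 : s < sInf ((slice Ω θ y)ᶜ ∩ Ici s) :=
    lt_of_le_of_ne m1.2 fun h => m1.1 (h ▸ hs)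
  have l2 : sSup ((slice Ω θ y)ᶜ ∩ Iic s) < s :=
    lt_of_le_of_ne m2.2 fun h => m2.1 (h.symm ▸ hs)
  refine ⟨_, _, ⟨l2.trans l1, fun t ht => ?_, m2.1, m1.1⟩, l2, l1⟩
  by_contra hn
  rcases le_total s t with h | h
  · exact absurd (csInf_le b1 ⟨hn, h⟩) (not_le.2 ht.2)
  · exact absurd (le_csSup b2 ⟨hn, h⟩) (not_le.2 ht.1)

theorem IsChord.eq_of_mem (h : IsChord Ω θ y α β) (h' : IsChord Ω θ y α' β')
    (hs : s ∈ Ioo α β) (hs' : s ∈ Ioo α' β') : α = α' ∧ β = β' := by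
  obtain ⟨-, i1, a1, b1⟩ := h
  obtain ⟨-, i2, a2, b2⟩ := h'
  have e1 : ¬ α < α' := fun h => a2 (i1 ⟨h, hs'.1.trans hs.2⟩)
  have e2 : ¬ α' < α := fun h => a1 (i2 ⟨h, hs.1.trans hs'.2⟩)
  have e3 : ¬ β < β' := fun h => b1 (i2 ⟨hs'.1.trans hs.2, h⟩)
  have e4 : ¬ β' < β := fun h => b2 (i1 ⟨hs.1.trans hs'.2, h⟩)
  exact ⟨le_antisymm (not_lt.1 e2) (not_lt.1 e1), le_antisymm (not_lt.1 e4) (not_lt.1 e3)⟩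

/-- The set of the chords of `Ω` on a line. -/
def chords (Ω : Set (Euc d)) (θ : Euc d) (y : Hyp θ) : Set (ℝ × ℝ) := {p | IsChord Ω θ y p.1 p.2}

theorem pairwiseDisjoint_chords : (chords Ω θ y).PairwiseDisjoint fun p => Ioo p.1 p.2 := by
  intro p hp q hq hpq
  refine Set.disjoint_left.2 fun s hs hs' => hpq ?_
  obtain ⟨e1, e2⟩ := IsChord.eq_of_mem hp hq hs hs'
  exact Prod.ext e1 e2

theorem countable_chords : (chords Ω θ y).Countable :=
  pairwiseDisjoint_chords.countable_of_isOpen (fun _ _ => isOpen_Ioo)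
    fun _ hp => nonempty_Ioo.2 hp.1

theorem slice_eq_iUnion_chords (hθ : ‖θ‖ = 1) (hΩ : IsOpen Ω) (hb : Bornology.IsBounded Ω) :
    slice Ω θ y = ⋃ p ∈ chords Ω θ y, Ioo p.1 p.2 := by
  ext s
  simp only [mem_iUnion, exists_prop]
  constructor
  · intro hs
    obtain ⟨α, β, h, h'⟩ := exists_isChord hθ hΩ hb hs
    exact ⟨(α, β), h, h'⟩
  · rintro ⟨p, hp, hs⟩
    exact hp.2.1 hs

/-- A slice is the disjoint union of countably many chords, so estimates may be proved chord by
chord. -/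
theorem lintegral_slice_le (hθ : ‖θ‖ = 1) (hΩ : IsOpen Ω) (hb : Bornology.IsBounded Ω)
    {F G : ℝ → ℝ≥0∞}
    (h : ∀ α β, IsChord Ω θ y α β → ∫⁻ s in Ioo α β, F s ≤ ∫⁻ s in Ioo α β, G s) :
    ∫⁻ s in slice Ω θ y, F s ≤ ∫⁻ s in slice Ω θ y, G s := by
  rw [slice_eq_iUnion_chords hθ hΩ hb,
    lintegral_biUnion countable_chords (fun _ _ => measurableSet_Ioo) pairwiseDisjoint_chords,
    lintegral_biUnion countable_chords (fun _ _ => measurableSet_Ioo) pairwiseDisjoint_chords]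
  exact ENNReal.tsum_le_tsum fun p => h _ _ p.2

theorem integral_slice_eq_zero (hθ : ‖θ‖ = 1) (hΩ : IsOpen Ω) (hb : Bornology.IsBounded Ω)
    {F : ℝ → ℝ} (hF : IntegrableOn F (slice Ω θ y))
    (h : ∀ α β, IsChord Ω θ y α β → ∫ s in Ioo α β, F s = 0) :
    ∫ s in slice Ω θ y, F s = 0 := by
  have := (countable_chords (Ω := Ω) (θ := θ) (y := y)).to_subtype
  rw [slice_eq_iUnion_chords hθ hΩ hb, biUnion_eq_iUnion] at hF ⊢
  rw [integral_iUnion (s := fun p : chords Ω θ y => Ioo p.1.1 p.1.2) (fun _ => measurableSet_Ioo)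
    (fun p q hpq => pairwiseDisjoint_chords p.2 q.2 (Subtype.coe_injective.ne hpq)) hF]
  exact (tsum_congr fun p : chords Ω θ y => h _ _ p.2).trans tsum_zero

/-- `Φ_θ` collapses a chord to its right end. This is why `μ_θ` gives that end the weight `β - α`,
and why an a.e. statement along a chord decides what happens at the end. -/
theorem IsChord.Phi_eq (hθ : ‖θ‖ = 1) (hb : Bornology.IsBounded Ω) (h : IsChord Ω θ y α β)
    (hs : s ∈ Ioo α β) : Phi Ω θ (s • θ + (y : Euc d)) = β • θ + (y : Euc d) := by
  have e : ∀ t : ℝ, s • θ + (y : Euc d) + t • θ = (s + t) • θ + (y : Euc d) := by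
    intro t; rw [add_smul]; abel
  have h1 : delta Ω θ (s • θ + (y : Euc d)) = β - s := by
    apply le_antisymm
    · refine le_of_not_gt fun hlt => h.2.2.2 ?_
      have := mem_of_lt_delta (Ω := Ω) (sub_nonneg.2 hs.2.le) hlt
      rw [e, add_sub_cancel] at this
      exact this
    · refine le_delta hb hθ (sub_nonneg.2 hs.2.le) fun t ht => ?_
      rw [e]
      exact h.2.1 ⟨by linarith [ht.1, hs.1], by linarith [ht.2]⟩
  rw [Phi, h1, e, add_sub_cancel]

theorem IsChord.mem_frontier (hθ : ‖θ‖ = 1) (hΩ : IsOpen Ω) (hb : Bornology.IsBounded Ω)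
    (h : IsChord Ω θ y α β) : β • θ + (y : Euc d) ∈ frontier Ω := by
  obtain ⟨s, hs⟩ := nonempty_Ioo.2 h.1
  rw [← h.Phi_eq hθ hb hs]
  exact Phi_mem_frontier hΩ hb hθ (h.2.1 hs)

/-- Traces see only right ends; reversing the direction gives access to the left ends. -/
theorem IsChord.neg (h : IsChord Ω θ y α β) {y' : Hyp (-θ)} (hy : (y' : Euc d) = y) :
    IsChord Ω (-θ) y' (-β) (-α) := by
  have e : ∀ t, t ∈ slice Ω (-θ) y' ↔ -t ∈ slice Ω θ y := by
    intro t; simp [slice, hy]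
  refine ⟨neg_lt_neg h.1, fun t ht => (e t).2 (h.2.1 ⟨by linarith [ht.2], by linarith [ht.1]⟩),
    ?_, ?_⟩
  · rw [e, neg_neg]; exact h.2.2.2
  · rw [e, neg_neg]; exact h.2.2.1

theorem Hyp_neg (θ : Euc d) : Hyp (-θ) = Hyp θ := by
  have : Submodule.span ℝ {-θ} = Submodule.span ℝ {θ} := by
    rw [← Set.neg_singleton, Submodule.span_neg]
  simp only [Hyp, this]

/-- The two hyperplanes are equal but not definitionally so; the predicate lives on the ambient
space so that the equality of subspaces can be eliminated. -/
theorem ae_hyp_neg {P : Euc d → Prop}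
    (h : ∀ᵐ y : Hyp (-θ) ∂(hypVolume (-θ)), P y) : ∀ᵐ y : Hyp θ ∂(hypVolume θ), P y := by
  have key : ∀ p q : Submodule ℝ (Euc d), p = q →
      (∀ᵐ y : p ∂(@volume p measureSpaceOfInnerProductSpace), P y) →
      ∀ᵐ y : q ∂(@volume q measureSpaceOfInnerProductSpace), P y := by
    rintro p q rfl h
    exact h
  exact key _ _ (Hyp_neg θ) h

end

section

variable {d : ℕ} {θ : Euc d} {Ω : Set (Euc d)}

/-! ### Weak derivatives on almost every line -/

/-- There is a countable family of compact sets that is cofinal among the compact subsets of any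
open subset of the line. -/
theorem exists_countable_compacts :
    ∃ 𝒞 : Set (Set ℝ), 𝒞.Countable ∧ (∀ C ∈ 𝒞, IsCompact C) ∧
      ∀ K U : Set ℝ, IsCompact K → IsOpen U → K ⊆ U → ∃ C ∈ 𝒞, K ⊆ C ∧ C ⊆ U := by
  refine ⟨range fun F : Finset (ℚ × ℚ) => ⋃ p ∈ F, Icc (p.1 : ℝ) p.2, countable_range _, ?_, ?_⟩
  · rintro _ ⟨F, rfl⟩
    exact F.isCompact_biUnion fun p _ => isCompact_Icc
  intro K U hK hU hKU
  suffices h : ∃ F : Finset (ℚ × ℚ), K ⊆ (⋃ p ∈ F, Icc (p.1 : ℝ) p.2) ∧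
      (⋃ p ∈ F, Icc (p.1 : ℝ) p.2) ⊆ U by
    obtain ⟨F, h1, h2⟩ := h
    exact ⟨_, ⟨F, rfl⟩, h1, h2⟩
  refine hK.induction_on (p := fun K => ∃ F : Finset (ℚ × ℚ), K ⊆ (⋃ p ∈ F, Icc (p.1 : ℝ) p.2) ∧
      (⋃ p ∈ F, Icc (p.1 : ℝ) p.2) ⊆ U) ⟨∅, by simp⟩ ?_ ?_ ?_
  · rintro s t hst ⟨F, h1, h2⟩
    exact ⟨F, hst.trans h1, h2⟩
  · classical
    rintro s t ⟨F, h1, h2⟩ ⟨F', h1', h2'⟩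
    refine ⟨F ∪ F', ?_, ?_⟩
    · rw [Finset.set_biUnion_union]
      exact union_subset_union h1 h1'
    · rw [Finset.set_biUnion_union]
      exact union_subset h2 h2'
  · intro x hx
    obtain ⟨ε, hε, hball⟩ := Metric.isOpen_iff.1 hU x (hKU hx)
    obtain ⟨p, hp1, hp2⟩ := exists_rat_btwn (sub_lt_self x hε)
    obtain ⟨q, hq1, hq2⟩ := exists_rat_btwn (lt_add_of_pos_right x hε)
    refine ⟨Icc p q, mem_nhdsWithin_of_mem_nhds (Icc_mem_nhds hp2 hq1), {(p, q)}, by simp, ?_⟩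
    simp only [Finset.mem_singleton, iUnion_iUnion_eq_left]
    intro t ht
    refine hball ?_
    rw [Real.ball_eq_Ioo]
    exact ⟨hp1.trans_le ht.1, ht.2.trans_lt hq2⟩

/-- A tube lemma. Test functions on this open set of `H_θ`, multiplied by test functions supported
in `C`, are supported in `Ω`. -/
theorem isOpen_setOf_subset_slice (hΩ : IsOpen Ω) (θ : Euc d) {C : Set ℝ} (hC : IsCompact C) :
    IsOpen {y : Hyp θ | C ⊆ slice Ω θ y} := by
  refine isOpen_iff_mem_nhds.2 fun y hy => ?_
  refine hC.eventually_forall_of_forall_eventually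
    (P := fun (y : Hyp θ) (t : ℝ) => t • θ + (y : Euc d) ∈ Ω) fun t ht => ?_
  have hc : Continuous fun z : Hyp θ × ℝ => z.2 • θ + (z.1 : Euc d) := by fun_prop
  exact hc.continuousAt.eventually_mem (hΩ.mem_nhds (hy ht))

/-- The product of a function on `H_θ` and of a function of the coordinate along `θ`. -/
def prodFun (θ : Euc d) (η : Hyp θ → ℝ) (ψ : ℝ → ℝ) (x : Euc d) : ℝ :=
  η ((Hyp θ).orthogonalProjectionOnto x) * ψ (inner ℝ θ x)

theorem prodFun_line (hθ : ‖θ‖ = 1) (η : Hyp θ → ℝ) (ψ : ℝ → ℝ) (y : Hyp θ) (s : ℝ) :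
    prodFun θ η ψ (s • θ + (y : Euc d)) = η y * ψ s := by
  rw [prodFun, (proj_line hθ y s).1, (proj_line hθ y s).2]

theorem contDiff_prodFun {η : Hyp θ → ℝ} {ψ : ℝ → ℝ} (hη : ContDiff ℝ ∞ η)
    (hψ : ContDiff ℝ ∞ ψ) : ContDiff ℝ ∞ (prodFun θ η ψ) :=
  (hη.comp (Hyp θ).orthogonalProjectionOnto.contDiff).mul (hψ.comp (contDiff_const.inner ℝ contDiff_id))

theorem isTestFunction_prodFun (hθ : ‖θ‖ = 1) {C : Set ℝ} {η : Hyp θ → ℝ} {ψ : ℝ → ℝ}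
    (hη : IsTestFunction {y : Hyp θ | C ⊆ slice Ω θ y} η) (hψ : IsTestFunction C ψ) :
    IsTestFunction Ω (prodFun θ η ψ) := by
  have hK : IsCompact (lineMap θ '' (tsupport η ×ˢ tsupport ψ)) :=
    (hη.compact.prod hψ.compact).image (continuous_lineMap θ)
  have hsub : tsupport (prodFun θ η ψ) ⊆ lineMap θ '' (tsupport η ×ˢ tsupport ψ) := by
    refine closure_minimal (fun x hx => ?_) hK.isClosed
    obtain ⟨⟨y, s⟩, rfl⟩ := exists_line hθ x
    have h1 : η y * ψ s ≠ 0 := by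
      rw [← prodFun_line hθ]; exact hx
    exact ⟨(y, s), ⟨subset_tsupport _ (left_ne_zero_of_mul h1),
      subset_tsupport _ (right_ne_zero_of_mul h1)⟩, rfl⟩
  refine ⟨contDiff_prodFun hη.smooth hψ.smooth, hK.of_isClosed_subset (isClosed_tsupport _) hsub,
    hsub.trans ?_⟩
  rintro _ ⟨⟨y, s⟩, ⟨h1, h2⟩, rfl⟩
  exact hη.supp h1 (hψ.supp h2)

theorem fderiv_prodFun (hθ : ‖θ‖ = 1) {η : Hyp θ → ℝ} {ψ : ℝ → ℝ} (hη : ContDiff ℝ ∞ η)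
    (hψ : ContDiff ℝ ∞ ψ) (x : Euc d) :
    fderiv ℝ (prodFun θ η ψ) x θ = prodFun θ η (deriv ψ) x := by
  obtain ⟨⟨y, s⟩, rfl⟩ := exists_line hθ x
  have h1 : HasDerivAt (fun s : ℝ => s • θ + (y : Euc d)) θ s := by
    simpa using ((hasDerivAt_id s).smul_const θ).add_const (y : Euc d)
  have h2 := (((contDiff_prodFun hη hψ).differentiable (by simp)) (lineMap θ (y, s))).hasFDerivAt
  have h3 := h2.comp_hasDerivAt s h1
  have h4 : (prodFun θ η ψ ∘ fun s : ℝ => s • θ + (y : Euc d)) = fun s => η y * ψ s :=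
    funext fun s => prodFun_line hθ η ψ y s
  rw [h4] at h3
  have h5 := ((hψ.differentiable (by simp)) s).hasDerivAt.const_mul (η y)
  exact (h3.unique h5).trans (prodFun_line hθ η _ y s).symm

/-- With `p = (ψ', ψ)` this is the defect in the weak derivative identity. Its `L²` continuity
extends the identity from a countable dense family to all test functions. -/
theorem continuous_setIntegral_pairing {S : Set ℝ} (hS : MeasurableSet S) {U W : ℝ → ℝ}
    (hU : MemLp U 2 (volume.restrict S)) (hW : MemLp W 2 (volume.restrict S)) :
    Continuous fun p : Lp ℝ 2 (volume : Measure ℝ) × Lp ℝ 2 (volume : Measure ℝ) =>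
      ∫ s in S, (U s * p.1 s + W s * p.2 s) := by
  have hU' := (memLp_indicator_iff_restrict hS).2 hU
  have hW' := (memLp_indicator_iff_restrict hS).2 hW
  have key : ∀ (U : ℝ → ℝ) (h : MemLp (S.indicator U) 2 volume) (p : Lp ℝ 2 (volume : Measure ℝ)),
      ∫ s in S, U s * p s = inner ℝ p (h.toLp _) := by
    intro U h p
    rw [L2.inner_def, ← integral_indicator hS]
    refine integral_congr_ae ?_
    filter_upwards [h.coeFn_toLp] with s hs
    rw [hs]
    by_cases hsS : s ∈ S <;> simp [hsS]
  have e : (fun p : Lp ℝ 2 (volume : Measure ℝ) × Lp ℝ 2 (volume : Measure ℝ) =>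
      ∫ s in S, (U s * p.1 s + W s * p.2 s)) = fun p => inner ℝ p.1 (hU'.toLp _)
        + inner ℝ p.2 (hW'.toLp _) := by
    ext p
    rw [← key U hU', ← key W hW']
    exact integral_add (hU.integrable_mul ((Lp.memLp p.1).restrict S))
      (hW.integrable_mul ((Lp.memLp p.2).restrict S))
  rw [e]
  fun_prop

theorem isFiniteMeasure_restrict (hb : Bornology.IsBounded Ω) :
    IsFiniteMeasure (volume.restrict Ω) :=
  ⟨by simpa using hb.measure_lt_top⟩

/-- The weak derivative along `θ`, tested against one function of the coordinate along `θ`. -/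
theorem ae_integral_slice_eq_zero (hθ : ‖θ‖ = 1) (hΩ : IsOpen Ω) (hb : Bornology.IsBounded Ω)
    {u w : Euc d → ℝ} (hu : MemLp u 2 (volume.restrict Ω)) (hw : MemLp w 2 (volume.restrict Ω))
    (h : IsWeakDirDeriv Ω θ u w) {C : Set ℝ} (hC : IsCompact C) {ψ : ℝ → ℝ}
    (hψ : IsTestFunction C ψ) :
    ∀ᵐ y : Hyp θ ∂(hypVolume θ), C ⊆ slice Ω θ y →
      ∫ s in slice Ω θ y, (u (s • θ + (y : Euc d)) * deriv ψ s + w (s • θ + (y : Euc d)) * ψ s)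
        = 0 := by
  have := isFiniteMeasure_restrict hb
  have iu : Integrable u (volume.restrict Ω) := hu.integrable (by norm_num)
  have iw : Integrable w (volume.restrict Ω) := hw.integrable (by norm_num)
  have cψ := hψ.smooth.continuous
  have cψ' : Continuous (deriv ψ) := hψ.smooth.continuous_deriv (by simp)
  obtain ⟨M, hM⟩ := hψ.compact.exists_bound_of_continuous cψ
  obtain ⟨M', hM'⟩ := hψ.compact.deriv.exists_bound_of_continuous cψ'
  have hin : Continuous fun x : Euc d => (inner ℝ θ x : ℝ) := by fun_prop
  set f : Euc d → ℝ := fun x => u x * deriv ψ (inner ℝ θ x) + w x * ψ (inner ℝ θ x) with hf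
  have hfi : Integrable f (volume.restrict Ω) :=
    (iu.mul_bdd (cψ'.comp hin).aestronglyMeasurable (Eventually.of_forall fun x => hM' _)).add
      (iw.mul_bdd (cψ.comp hin).aestronglyMeasurable (Eventually.of_forall fun x => hM _))
  have hline : ∀ (y : Hyp θ) (s : ℝ), f (s • θ + (y : Euc d))
      = u (s • θ + (y : Euc d)) * deriv ψ s + w (s • θ + (y : Euc d)) * ψ s := by
    intro y s
    simp only [hf, (proj_line hθ y s).2]
  obtain ⟨hFi, -⟩ := integral_lines hθ hΩ hfi
  simp only [hline] at hFi
  -- By the fundamental lemma on `H_θ`, it suffices to integrate against each test function `η` of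
  -- `y`; this amounts to testing the weak derivative on `Ω` with `prodFun θ η ψ`.
  refine (isOpen_setOf_subset_slice hΩ θ hC).ae_eq_zero_of_integral_contDiff_smul_eq_zero
    (hFi.locallyIntegrable.locallyIntegrableOn _) fun η h1 h2 h3 => ?_
  have hη : IsTestFunction {y : Hyp θ | C ⊆ slice Ω θ y} η := ⟨h1, h2, h3⟩
  have hφ := isTestFunction_prodFun hθ hη hψ
  have h4 := h _ hφ
  simp only [fderiv_prodFun hθ hη.smooth hψ.smooth] at h4
  obtain ⟨N, hN⟩ := h2.exists_bound_of_continuous h1.continuous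
  have cP : Continuous fun x : Euc d => η ((Hyp θ).orthogonalProjectionOnto x) :=
    h1.continuous.comp (Hyp θ).orthogonalProjectionOnto.continuous
  have hgi : Integrable (fun x => f x * η ((Hyp θ).orthogonalProjectionOnto x))
      (volume.restrict Ω) :=
    hfi.mul_bdd cP.aestronglyMeasurable (Eventually.of_forall fun x => hN _)
  have i1 : Integrable (fun x => u x * prodFun θ η (deriv ψ) x) (volume.restrict Ω) := by
    have := (iu.mul_bdd (cψ'.comp hin).aestronglyMeasurable
      (Eventually.of_forall fun x => hM' _)).mul_bdd cP.aestronglyMeasurable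
      (Eventually.of_forall fun x => hN _)
    refine this.congr (Eventually.of_forall fun x => ?_)
    simp only [prodFun, Function.comp]; ring
  have i2 : Integrable (fun x => w x * prodFun θ η ψ x) (volume.restrict Ω) := by
    have := (iw.mul_bdd (cψ.comp hin).aestronglyMeasurable
      (Eventually.of_forall fun x => hM _)).mul_bdd cP.aestronglyMeasurable
      (Eventually.of_forall fun x => hN _)
    refine this.congr (Eventually.of_forall fun x => ?_)
    simp only [prodFun, Function.comp]; ring
  have h5 : ∫ x in Ω, f x * η ((Hyp θ).orthogonalProjectionOnto x) = 0 := by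
    have e : ∀ x, f x * η ((Hyp θ).orthogonalProjectionOnto x)
        = u x * prodFun θ η (deriv ψ) x + w x * prodFun θ η ψ x := by
      intro x; simp only [hf, prodFun]; ring
    simp only [e]
    rw [integral_add i1 i2, h4]
    ring
  rw [(integral_lines hθ hΩ hgi).2] at h5
  rw [← h5]
  refine integral_congr_ae (Eventually.of_forall fun y => ?_)
  simp only [smul_eq_mul]
  rw [← integral_const_mul]
  congr 1
  ext s
  rw [hline, (proj_line hθ y s).1]
  ring

/-- A weak derivative along `θ` is, on almost every line of direction `θ`, a weak derivative. -/
theorem ae_isWeakDirDeriv_slice (hθ : ‖θ‖ = 1) (hΩ : IsOpen Ω) (hb : Bornology.IsBounded Ω)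
    {u w : Euc d → ℝ} (hu : MemLp u 2 (volume.restrict Ω)) (hw : MemLp w 2 (volume.restrict Ω))
    (h : IsWeakDirDeriv Ω θ u w) :
    ∀ᵐ y : Hyp θ ∂(hypVolume θ), IsWeakDirDeriv (slice Ω θ y) (1 : ℝ)
      (fun s => u (s • θ + (y : Euc d))) (fun s => w (s • θ + (y : Euc d))) := by
  obtain ⟨𝒞, hcount, hcomp, hcof⟩ := exists_countable_compacts
  -- The exceptional null set of lines must not depend on `ψ`. For each of countably many compacts
  -- `C`, the pairs `(ψ', ψ)` lie in a separable space, so countably many `ψ` suffice.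
  let T : Set ℝ → Set (Lp ℝ 2 (volume : Measure ℝ) × Lp ℝ 2 (volume : Measure ℝ)) := fun C =>
    {p | ∃ ψ, IsTestFunction C ψ ∧ p.1 =ᵐ[volume] deriv ψ ∧ p.2 =ᵐ[volume] ψ}
  have : Fact ((2 : ℝ≥0∞) ≠ ⊤) := ⟨by norm_num⟩
  have hsep : ∀ C, ∃ t ⊆ T C, t.Countable ∧ T C ⊆ closure t := fun C =>
    (TopologicalSpace.IsSeparable.of_separableSpace (T C)).exists_countable_dense_subset
  choose t ht1 ht2 ht3 using hsep
  have hpair : ∀ (y : Hyp θ) (p : Lp ℝ 2 (volume : Measure ℝ) × Lp ℝ 2 (volume : Measure ℝ))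
      (ψ : ℝ → ℝ), p.1 =ᵐ[volume] deriv ψ → p.2 =ᵐ[volume] ψ →
      ∫ s in slice Ω θ y, (u (s • θ + (y : Euc d)) * p.1 s + w (s • θ + (y : Euc d)) * p.2 s)
      = ∫ s in slice Ω θ y,
        (u (s • θ + (y : Euc d)) * deriv ψ s + w (s • θ + (y : Euc d)) * ψ s) := by
    intro y p ψ h1 h2
    refine integral_congr_ae (ae_restrict_of_ae ?_)
    filter_upwards [h1, h2] with s e1 e2
    rw [e1, e2]
  have key : ∀ᵐ y : Hyp θ ∂(hypVolume θ), ∀ C ∈ 𝒞, ∀ p ∈ t C, C ⊆ slice Ω θ y →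
      ∫ s in slice Ω θ y, (u (s • θ + (y : Euc d)) * p.1 s + w (s • θ + (y : Euc d)) * p.2 s)
        = 0 := by
    rw [ae_ball_iff hcount]
    intro C hC
    rw [ae_ball_iff (ht2 C)]
    intro p hp
    obtain ⟨ψ, hψ, e1, e2⟩ := ht1 C hp
    filter_upwards [ae_integral_slice_eq_zero hθ hΩ hb hu hw h (hcomp C hC) hψ] with y hy hCy
    rw [hpair y p ψ e1 e2, hy hCy]
  filter_upwards [key, memLp_lines hθ hΩ hu, memLp_lines hθ hΩ hw] with y hy hyu hyw ψ hψ
  have hS := isOpen_slice hΩ y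
  obtain ⟨C, hC, hC1, hC2⟩ := hcof _ _ hψ.compact hS hψ.supp
  have cψ' : Continuous (deriv ψ) := hψ.smooth.continuous_deriv (by simp)
  have m1 : MemLp (deriv ψ) 2 (volume : Measure ℝ) :=
    cψ'.memLp_of_hasCompactSupport hψ.compact.deriv
  have m2 : MemLp ψ 2 (volume : Measure ℝ) :=
    hψ.smooth.continuous.memLp_of_hasCompactSupport hψ.compact
  have hmem : (m1.toLp _, m2.toLp _) ∈ T C :=
    ⟨ψ, ⟨hψ.smooth, hψ.compact, hC1⟩, m1.coeFn_toLp, m2.coeFn_toLp⟩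
  have hcl := closure_minimal (s := t C)
    (t := {p | ∫ s in slice Ω θ y, (u (s • θ + (y : Euc d)) * p.1 s
      + w (s • θ + (y : Euc d)) * p.2 s) = 0})
    (fun p hp => hy C hC p hp hC2)
    (isClosed_eq (continuous_setIntegral_pairing hS.measurableSet hyu hyw) continuous_const)
    (ht3 C hmem)
  have h1 : ∫ s in slice Ω θ y,
      (u (s • θ + (y : Euc d)) * deriv ψ s + w (s • θ + (y : Euc d)) * ψ s) = 0 :=
    (hpair y _ ψ m1.coeFn_toLp m2.coeFn_toLp).symm.trans hcl
  have h2 := (integral_add (hyu.integrable_mul (m1.restrict _))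
    (hyw.integrable_mul (m2.restrict _))).symm.trans h1
  simp only [Pi.mul_apply] at h2
  simp only [fderiv_apply_one_eq_deriv]
  linarith

end

section

/-! ### Squares in `[0, ∞]` -/

section Squares

variable {X : Type*} [MeasurableSpace X] {μ : Measure X}

theorem eLpNorm_two_sq {F : Type*} [NormedAddCommGroup F] (f : X → F) :
    eLpNorm f 2 μ ^ 2 = ∫⁻ x, ‖f x‖ₑ ^ 2 ∂μ := by
  rw [eLpNorm_eq_lintegral_rpow_enorm_toReal (by norm_num) (by norm_num), ← ENNReal.rpow_natCast,
    ← ENNReal.rpow_mul]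
  norm_num

theorem add_sq_le_two_mul (a b : ℝ≥0∞) : (a + b) ^ 2 ≤ 2 * (a ^ 2 + b ^ 2) := by
  have := ENNReal.rpow_add_le_mul_rpow_add_rpow a b (p := 2) (by norm_num)
  norm_num at this
  exact this

/-- Cauchy–Schwarz against the constant `1`. -/
theorem sq_lintegral_le {f : X → ℝ≥0∞} (hf : AEMeasurable f μ) :
    (∫⁻ x, f x ∂μ) ^ 2 ≤ μ univ * ∫⁻ x, f x ^ 2 ∂μ := by
  have h := ENNReal.lintegral_mul_le_Lp_mul_Lq μ Real.HolderConjugate.two_two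
    (aemeasurable_const (b := (1 : ℝ≥0∞))) hf
  simp only [Pi.mul_apply, one_mul, one_pow, lintegral_const, ENNReal.rpow_two] at h
  calc (∫⁻ x, f x ∂μ) ^ 2 ≤ (μ univ ^ (1 / 2 : ℝ) * (∫⁻ x, f x ^ 2 ∂μ) ^ (1 / 2 : ℝ)) ^ 2 := by
        gcongr
    _ = μ univ * ∫⁻ x, f x ^ 2 ∂μ := by
        rw [← ENNReal.mul_rpow_of_nonneg _ _ (by norm_num), ← ENNReal.rpow_natCast,
          ← ENNReal.rpow_mul]
        norm_num

end Squares

variable {d : ℕ} {θ : Euc d} {Ω : Set (Euc d)} {α β R : ℝ}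

/-! ### Elements of `H¹(Ω)` on lines -/

/-- A function representing the gradient of `u ∈ H¹(Ω)`. -/
def H1grad (u : H1 Ω) : Euc d → Euc d := u.1.snd

theorem memLp_H1rep (u : H1 Ω) : MemLp (H1rep u) 2 (volume.restrict Ω) := Lp.memLp _

theorem memLp_H1grad (u : H1 Ω) : MemLp (H1grad u) 2 (volume.restrict Ω) := Lp.memLp _

/-- The energy density `|u|² + |∇u|²`. -/
def energy (u : H1 Ω) (x : Euc d) : ℝ≥0∞ := ‖H1rep u x‖ₑ ^ 2 + ‖H1grad u x‖ₑ ^ 2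

theorem aemeasurable_energy (u : H1 Ω) : AEMeasurable (energy u) (volume.restrict Ω) :=
  ((memLp_H1rep u).1.enorm.pow_const 2).add ((memLp_H1grad u).1.enorm.pow_const 2)

theorem lintegral_energy (u : H1 Ω) : ∫⁻ x in Ω, energy u x = ‖u‖ₑ ^ 2 := by
  have h1 : ‖u‖ ^ 2 = ‖u.1.fst‖ ^ 2 + ‖u.1.snd‖ ^ 2 := WithLp.prod_norm_sq_eq_of_L2 u.1
  have h2 : ‖u‖ₑ ^ 2 = ‖u.1.fst‖ₑ ^ 2 + ‖u.1.snd‖ₑ ^ 2 := by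
    simp only [← ofReal_norm]
    rw [← ENNReal.ofReal_pow (norm_nonneg _), ← ENNReal.ofReal_pow (norm_nonneg _),
      ← ENNReal.ofReal_pow (norm_nonneg _), h1,
      ENNReal.ofReal_add (by positivity) (by positivity)]
  rw [h2, Lp.enorm_def, Lp.enorm_def, eLpNorm_two_sq, eLpNorm_two_sq]
  exact lintegral_add_left' ((memLp_H1rep u).1.enorm.pow_const 2) _

theorem H1rep_sub (u v : H1 Ω) :
    H1rep (u - v) =ᵐ[volume.restrict Ω] fun x => H1rep u x - H1rep v x :=
  Lp.coeFn_sub u.1.fst v.1.fst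

/-- The derivative along `θ` of `u ∈ H¹(Ω)` on the line `y + ℝθ`. -/
def lineDerivRep (u : H1 Ω) (θ : Euc d) (y : Hyp θ) (s : ℝ) : ℝ :=
  inner ℝ (H1grad u (s • θ + (y : Euc d))) θ

/-- The restriction of `u ∈ H¹(Ω)` to the line `y + ℝθ` is in `H¹(ω_θ(y))`, its derivative being
given by the gradient of `u`. -/
structure IsGoodLine (u : H1 Ω) (θ : Euc d) (y : Hyp θ) : Prop where
  memLp : MemLp (fun s : ℝ => H1rep u (s • θ + (y : Euc d))) 2 (volume.restrict (slice Ω θ y))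
  memLp_grad :
    MemLp (fun s : ℝ => H1grad u (s • θ + (y : Euc d))) 2 (volume.restrict (slice Ω θ y))
  weakDeriv : IsWeakDirDeriv (slice Ω θ y) (1 : ℝ) (fun s => H1rep u (s • θ + (y : Euc d)))
    (lineDerivRep u θ y)

theorem ae_isGoodLine (hθ : ‖θ‖ = 1) (hΩ : IsOpen Ω) (hb : Bornology.IsBounded Ω) (u : H1 Ω) :
    ∀ᵐ y : Hyp θ ∂(hypVolume θ), IsGoodLine u θ y := by
  filter_upwards [memLp_lines hθ hΩ (memLp_H1rep u), memLp_lines hθ hΩ (memLp_H1grad u),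
    ae_isWeakDirDeriv_slice hθ hΩ hb (memLp_H1rep u) ((memLp_H1grad u).inner_const θ) (u.2 θ)]
    with y h1 h2 h3
  exact ⟨h1, h2, h3⟩

namespace IsGoodLine

variable {u : H1 Ω} {y : Hyp θ}

theorem memLp_lineDerivRep (h : IsGoodLine u θ y) :
    MemLp (lineDerivRep u θ y) 2 (volume.restrict (slice Ω θ y)) :=
  h.memLp_grad.inner_const θ

theorem integrableOn_lineDerivRep (h : IsGoodLine u θ y) (hc : IsChord Ω θ y α β) :
    IntegrableOn (lineDerivRep u θ y) (Ioo α β) :=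
  (h.memLp_lineDerivRep.mono_measure (Measure.restrict_mono_set _ hc.2.1)).integrable (by norm_num)

theorem exists_eq_primitive (h : IsGoodLine u θ y) (hΩ : IsOpen Ω) (hc : IsChord Ω θ y α β) :
    ∃ c, ∀ᵐ s ∂(volume.restrict (Ioo α β)),
      H1rep u (s • θ + (y : Euc d)) = c + ∫ t in α..s, lineDerivRep u θ y t :=
  OmniTrace.exists_eq_primitive hc.1
    ((h.memLp.mono_measure (Measure.restrict_mono_set _ hc.2.1)).integrable (by norm_num))
    (h.integrableOn_lineDerivRep hc) (h.weakDeriv.mono (isOpen_slice hΩ y) hc.2.1)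

end IsGoodLine

/-- `f` is the continuous representative of `u` on the chord `]α, β]`. -/
def IsChordRep (u : Euc d → ℝ) (θ : Euc d) (y : Hyp θ) (α β : ℝ) (f : ℝ → ℝ) : Prop :=
  ContinuousOn f (Ioc α β) ∧
    ∀ᵐ s ∂(volume.restrict (Ioo α β)), f s = u (s • θ + (y : Euc d))

/-- Left continuity at `β` fixes the value there, so the trace does not depend on the continuous
representative. -/
theorem eqOn_Ioc_of_ae_Ioo {f g : ℝ → ℝ} (hf : ContinuousOn f (Ioc α β))
    (hg : ContinuousOn g (Ioc α β)) (h : ∀ᵐ s ∂(volume.restrict (Ioo α β)), f s = g s) :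
    EqOn f g (Ioc α β) := by
  refine Measure.eqOn_Ioc_of_ae_eq (μ := volume) ?_ hf hg
  rwa [Measure.restrict_congr_set Ioo_ae_eq_Ioc.symm]

/-- The constant of the trace inequality on a domain contained in a ball of radius `R`. -/
def traceConst (R : ℝ) : ℝ≥0∞ := 2 + 2 * ENNReal.ofReal (2 * R) ^ 2

theorem traceConst_ne_top (R : ℝ) : traceConst R ≠ ⊤ := by
  unfold traceConst; finiteness

/-- The trace inequality on a chord. -/
theorem IsGoodLine.trace_le {u : H1 Ω} {y : Hyp θ} (h : IsGoodLine u θ y) (hθ : ‖θ‖ = 1)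
    (hΩ : IsOpen Ω) (hR : Ω ⊆ Metric.closedBall 0 R) (hc : IsChord Ω θ y α β) {f : ℝ → ℝ}
    (hf : IsChordRep (H1rep u) θ y α β f) :
    ‖f β‖ₑ ^ 2 * ENNReal.ofReal (β - α)
      ≤ traceConst R * ∫⁻ s in Ioo α β, energy u (s • θ + (y : Euc d)) := by
  set w := lineDerivRep u θ y
  set μ := volume.restrict (Ioo α β) with hμ
  have hαβ := hc.1
  have hwi : IntegrableOn w (Ioo α β) := h.integrableOn_lineDerivRep hc
  obtain ⟨c, hcs⟩ := h.exists_eq_primitive hΩ hc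
  have hcont := continuousOn_primitive hαβ.le hwi c
  have heq := eqOn_Ioc_of_ae_Ioo hf.1 (hcont.mono Ioc_subset_Icc_self)
    (by filter_upwards [hf.2, hcs] with s h1 h2; rw [h1, h2])
  have hL : μ univ = ENNReal.ofReal (β - α) := by simp [hμ]
  have hLR : ENNReal.ofReal (β - α) ≤ ENNReal.ofReal (2 * R) := by
    have h1 := hc.subset_Icc hθ hR (left_mem_Icc.2 hαβ.le)
    have h2 := hc.subset_Icc hθ hR (right_mem_Icc.2 hαβ.le)
    exact ENNReal.ofReal_le_ofReal (by linarith [h1.1, h2.2])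
  set W := ∫⁻ s, ‖w s‖ₑ ^ 2 ∂μ with hW
  -- Square `f(β) = u(s) + ∫_s^β w` and bound the integral by Cauchy–Schwarz over the whole chord.
  -- Integrating in `s` then produces the factor `β - α` on the left, and `2 (β - α)² ≤ 2 (2R)²` in
  -- front of the derivative term.
  have hpt : ∀ᵐ s ∂μ, ‖f β‖ₑ ^ 2
      ≤ 2 * (‖H1rep u (s • θ + (y : Euc d))‖ₑ ^ 2 + ENNReal.ofReal (β - α) * W) := by
    filter_upwards [hcs, ae_restrict_mem measurableSet_Ioo] with s hs hsm
    have e : f β = H1rep u (s • θ + (y : Euc d)) + ∫ t in s..β, w t := by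
      rw [heq ⟨hαβ, le_rfl⟩, hs]
      simp only
      rw [add_assoc, intervalIntegral.integral_add_adjacent_intervals]
      · exact (intervalIntegrable_of_Ioo hsm.1.le (hwi.mono_set (Ioo_subset_Ioo_right hsm.2.le)))
      · exact (intervalIntegrable_of_Ioo hsm.2.le (hwi.mono_set (Ioo_subset_Ioo_left hsm.1.le)))
    have e2 : ‖∫ t in s..β, w t‖ₑ ≤ ∫⁻ t, ‖w t‖ₑ ∂μ := by
      rw [intervalIntegral_eq_Ioo hsm.2.le]
      exact (enorm_integral_le_lintegral_enorm _).trans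
        (lintegral_mono_set (Ioo_subset_Ioo_left hsm.1.le))
    have e3 : (∫⁻ t, ‖w t‖ₑ ∂μ) ^ 2 ≤ ENNReal.ofReal (β - α) * W := by
      rw [← hL]
      exact sq_lintegral_le hwi.1.enorm
    calc ‖f β‖ₑ ^ 2 ≤ (‖H1rep u (s • θ + (y : Euc d))‖ₑ + ∫⁻ t, ‖w t‖ₑ ∂μ) ^ 2 := by
          rw [e]
          gcongr
          exact (enorm_add_le _ _).trans (by gcongr)
      _ ≤ 2 * (‖H1rep u (s • θ + (y : Euc d))‖ₑ ^ 2 + (∫⁻ t, ‖w t‖ₑ ∂μ) ^ 2) :=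
          add_sq_le_two_mul _ _
      _ ≤ _ := by gcongr
  have hrm : AEMeasurable (fun s : ℝ => ‖H1rep u (s • θ + (y : Euc d))‖ₑ ^ 2) μ :=
    (h.memLp.1.mono_measure (Measure.restrict_mono_set _ hc.2.1)).enorm.pow_const 2
  have hWle : W ≤ ∫⁻ s, ‖H1grad u (s • θ + (y : Euc d))‖ₑ ^ 2 ∂μ := by
    refine lintegral_mono fun s => ?_
    simp only
    gcongr
    rw [enorm_le_iff_norm_le]
    refine (norm_inner_le_norm _ _).trans ?_
    rw [hθ, mul_one]
  calc ‖f β‖ₑ ^ 2 * ENNReal.ofReal (β - α) = ∫⁻ _, ‖f β‖ₑ ^ 2 ∂μ := by rw [lintegral_const, hL]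
    _ ≤ ∫⁻ s, 2 * (‖H1rep u (s • θ + (y : Euc d))‖ₑ ^ 2 + ENNReal.ofReal (β - α) * W) ∂μ :=
        lintegral_mono_ae hpt
    _ = 2 * (∫⁻ s, ‖H1rep u (s • θ + (y : Euc d))‖ₑ ^ 2 ∂μ)
          + 2 * ENNReal.ofReal (β - α) ^ 2 * W := by
        rw [lintegral_const_mul' _ _ (by norm_num), lintegral_add_left' hrm, lintegral_const, hL]
        ring
    _ ≤ traceConst R * (∫⁻ s, ‖H1rep u (s • θ + (y : Euc d))‖ₑ ^ 2 ∂μ)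
          + traceConst R * ∫⁻ s, ‖H1grad u (s • θ + (y : Euc d))‖ₑ ^ 2 ∂μ := by
        unfold traceConst
        gcongr
        · exact le_self_add
        · exact (by gcongr : 2 * ENNReal.ofReal (β - α) ^ 2
            ≤ 2 * ENNReal.ofReal (2 * R) ^ 2).trans le_add_self
    _ = _ := by
        rw [← mul_add, ← lintegral_add_left' hrm]
        rfl

end

section

variable {d : ℕ} {θ : Euc d} {Ω : Set (Euc d)} {α β R : ℝ}

/-! ### Directional traces -/

/-- On almost every line of direction `θ`, `g` gives the values at the right ends of the chords of
the continuous representative of `u`. -/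
def HasLineTraces (Ω : Set (Euc d)) (θ : Euc d) (u g : Euc d → ℝ) : Prop :=
  ∀ᵐ y : Hyp θ ∂(hypVolume θ), ∀ α β, IsChord Ω θ y α β →
    ∃ f, IsChordRep u θ y α β f ∧ g (β • θ + (y : Euc d)) = f β

/-- On almost every line `u'` agrees a.e. with `u`, so the choice of representative is immaterial;
and a `y` whose line carries a chord lies in `projSet Ω θ`, so nothing is asked of the others. -/
theorem IsDirTrace.hasLineTraces (hθ : ‖θ‖ = 1) (hΩ : IsOpen Ω) {u g : Euc d → ℝ}
    (h : IsDirTrace Ω θ u g) : HasLineTraces Ω θ u g := by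
  obtain ⟨u', hu', A, -, hA0, hA⟩ := h
  filter_upwards [ae_lines hθ hΩ hu', measure_eq_zero_iff_ae_notMem.1 hA0] with y hy hyA α β hc
  obtain ⟨s, hs⟩ := nonempty_Ioo.2 hc.1
  have hyA' : y ∈ A := by
    by_contra hn
    exact hyA ⟨mem_projSet_of_mem_slice hθ (hc.2.1 hs), hn⟩
  obtain ⟨f, hf1, hf2, hf3⟩ := (hA y hyA').2 α β hc
  refine ⟨f, ⟨hf1, ?_⟩, hf3⟩
  filter_upwards [hf2, ae_restrict_of_ae_restrict_of_subset hc.2.1 hy] with s h1 h2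
  rw [h1, h2]

theorem HasLineTraces.isDirTrace (hθ : ‖θ‖ = 1) (hΩ : IsOpen Ω) (hb : Bornology.IsBounded Ω)
    {u : H1 Ω} {g : Euc d → ℝ} (h : HasLineTraces Ω θ (H1rep u) g) :
    IsDirTrace Ω θ (H1rep u) g := by
  have key := h.and (ae_isGoodLine hθ hΩ hb u)
  refine ⟨H1rep u, ae_eq_refl _, projSet Ω θ ∩ {y | (∀ α β, IsChord Ω θ y α β →
    ∃ f, IsChordRep (H1rep u) θ y α β f ∧ g (β • θ + (y : Euc d)) = f β) ∧ IsGoodLine u θ y},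
    inter_subset_left, ?_, ?_⟩
  · rw [measure_eq_zero_iff_ae_notMem]
    filter_upwards [key] with y hy hn
    exact hn.2 ⟨hn.1, hy⟩
  · rintro y ⟨-, hy1, hy2⟩
    refine ⟨⟨hy2.memLp, _, hy2.memLp_lineDerivRep, hy2.weakDeriv⟩, fun α β hc => ?_⟩
    obtain ⟨f, hf, hfβ⟩ := hy1 α β hc
    exact ⟨f, hf.1, hf.2, hfβ⟩

theorem HasLineTraces.sub (hθ : ‖θ‖ = 1) (hΩ : IsOpen Ω) {u v : H1 Ω} {g h : Euc d → ℝ}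
    (hg : HasLineTraces Ω θ (H1rep u) g) (hh : HasLineTraces Ω θ (H1rep v) h) :
    HasLineTraces Ω θ (H1rep (u - v)) (g - h) := by
  filter_upwards [hg, hh, ae_lines hθ hΩ (H1rep_sub u v)] with y h1 h2 h3 α β hc
  obtain ⟨f1, hf1, e1⟩ := h1 α β hc
  obtain ⟨f2, hf2, e2⟩ := h2 α β hc
  refine ⟨f1 - f2, ⟨hf1.1.sub hf2.1, ?_⟩, by simp [e1, e2]⟩
  filter_upwards [hf1.2, hf2.2, ae_restrict_of_ae_restrict_of_subset hc.2.1 h3] with s a b c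
  rw [c, Pi.sub_apply, a, b]

theorem IsContRep.hasLineTraces (hθ : ‖θ‖ = 1) (hΩ : IsOpen Ω) (hb : Bornology.IsBounded Ω)
    {u : H1 Ω} {f : Euc d → ℝ} (h : IsContRep u f) : HasLineTraces Ω θ (H1rep u) f := by
  filter_upwards [ae_lines hθ hΩ h.2] with y hy α β hc
  refine ⟨fun s => f (s • θ + (y : Euc d)), ⟨?_, ?_⟩, rfl⟩
  · refine h.1.comp (continuous_line θ y).continuousOn fun s hs => ?_
    rcases eq_or_lt_of_le hs.2 with e | e
    · rw [e]
      exact frontier_subset_closure (hc.mem_frontier hθ hΩ hb)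
    · exact subset_closure (hc.2.1 ⟨hs.1, e⟩)
  · filter_upwards [ae_restrict_of_ae_restrict_of_subset hc.2.1 hy] with s hs
    exact hs.symm

theorem ae_frontier_dirMeasure (hθ : ‖θ‖ = 1) (hΩ : IsOpen Ω) (hb : Bornology.IsBounded Ω) :
    ∀ᵐ z ∂(dirMeasure Ω θ), z ∈ frontier Ω := by
  rw [ae_iff]
  exact dirMeasure_compl_frontier hΩ hb hθ

/-- `f` is arbitrary off `Ω̄`, but `μ_θ` is carried by the closed set `∂Ω`, on which `f` is
continuous. -/
theorem IsContRep.aestronglyMeasurable (hθ : ‖θ‖ = 1) (hΩ : IsOpen Ω)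
    (hb : Bornology.IsBounded Ω) {u : H1 Ω} {f : Euc d → ℝ} (h : IsContRep u f) :
    AEStronglyMeasurable f (dirMeasure Ω θ) := by
  have h1 := (h.1.mono frontier_subset_closure).aestronglyMeasurable (μ := dirMeasure Ω θ)
    isClosed_frontier.measurableSet
  rwa [Measure.restrict_eq_self_of_ae_mem (ae_frontier_dirMeasure hθ hΩ hb)] at h1

/-- The trace inequality. -/
theorem HasLineTraces.eLpNorm_le (hθ : ‖θ‖ = 1) (hΩ : IsOpen Ω)
    (hR : Ω ⊆ Metric.closedBall 0 R) {u : H1 Ω} {h g : Euc d → ℝ}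
    (hh : HasLineTraces Ω θ (H1rep u) h) (hg : AEStronglyMeasurable g (dirMeasure Ω θ))
    (hhg : h =ᵐ[dirMeasure Ω θ] g) :
    eLpNorm g 2 (dirMeasure Ω θ) ≤ traceConst R ^ (1 / 2 : ℝ) * ‖u‖ₑ := by
  have hb : Bornology.IsBounded Ω := Metric.isBounded_closedBall.subset hR
  have hΦ := aemeasurable_Phi (θ := θ) hΩ hb hθ
  have h1 : eLpNorm g 2 (dirMeasure Ω θ) ^ 2 ≤ traceConst R * ‖u‖ₑ ^ 2 := by
    rw [eLpNorm_two_sq]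
    have e1 : ∫⁻ z, ‖g z‖ₑ ^ 2 ∂(dirMeasure Ω θ) = ∫⁻ x in Ω, ‖g (Phi Ω θ x)‖ₑ ^ 2 :=
      lintegral_map' (hg.enorm.pow_const 2) hΦ
    have e2 : ∫⁻ x in Ω, ‖g (Phi Ω θ x)‖ₑ ^ 2 = ∫⁻ y : Hyp θ,
        (∫⁻ s in slice Ω θ y, ‖g (Phi Ω θ (s • θ + (y : Euc d)))‖ₑ ^ 2) ∂(hypVolume θ) :=
      lintegral_lines hθ hΩ (F := fun x => ‖g (Phi Ω θ x)‖ₑ ^ 2)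
        ((hg.comp_aemeasurable hΦ).enorm.pow_const 2)
    rw [e1, e2, ← lintegral_energy, ← lintegral_const_mul' _ _ (traceConst_ne_top R),
      lintegral_lines hθ hΩ ((aemeasurable_energy u).const_mul _)]
    refine lintegral_mono_ae ?_
    filter_upwards [hh, ae_isGoodLine hθ hΩ hb u, ae_lines hθ hΩ (ae_of_ae_map hΦ hhg)]
      with y hy hgood hΦy
    refine lintegral_slice_le hθ hΩ hb fun α β hc => ?_
    obtain ⟨f, hf, hfβ⟩ := hy α β hc
    rw [lintegral_const_mul' _ _ (traceConst_ne_top R)]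
    refine le_trans ?_ (hgood.trace_le hθ hΩ hR hc hf)
    -- Along the chord `g ∘ Φ_θ` is a.e. the constant `f β`, so its squared integral is the left
    -- side of the chord inequality.
    have e3 : ‖f β‖ₑ ^ 2 * ENNReal.ofReal (β - α) = ∫⁻ _ in Ioo α β, ‖f β‖ₑ ^ 2 := by
      rw [lintegral_const]; simp
    rw [e3]
    refine lintegral_mono_ae ?_
    filter_upwards [ae_restrict_of_ae_restrict_of_subset hc.2.1 hΦy,
      ae_restrict_mem measurableSet_Ioo] with s hs hsm
    rw [← hs, hc.Phi_eq hθ hb hsm, hfβ]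
  calc eLpNorm g 2 (dirMeasure Ω θ) = (eLpNorm g 2 (dirMeasure Ω θ) ^ 2) ^ (1 / 2 : ℝ) := by
        rw [← ENNReal.rpow_natCast, ← ENNReal.rpow_mul]; norm_num
    _ ≤ (traceConst R * ‖u‖ₑ ^ 2) ^ (1 / 2 : ℝ) := by gcongr
    _ = _ := by
        rw [ENNReal.mul_rpow_of_nonneg _ _ (by norm_num), ← ENNReal.rpow_natCast ‖u‖ₑ,
          ← ENNReal.rpow_mul]
        norm_num

/-! ### Omnidirectional traces -/

theorem enorm_zero_H1 : ‖(0 : H1 Ω)‖ₑ = 0 := by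
  rw [← ofReal_norm, norm_zero, ENNReal.ofReal_zero]

theorem norm_eq_of_mem_sph (hθ : θ ∈ Sph d) : ‖θ‖ = 1 := by simpa using hθ

theorem IsOmniTrace.exists_hasLineTraces (hΩ : IsOpen Ω) {u : H1 Ω} {g : Euc d → ℝ}
    (hg : IsOmniTrace u g) (hθ : θ ∈ Sph d) :
    ∃ h, HasLineTraces Ω θ (H1rep u) h ∧ h =ᵐ[dirMeasure Ω θ] g := by
  obtain ⟨h, h1, h2⟩ := hg.2 θ hθ
  exact ⟨h, h1.hasLineTraces (norm_eq_of_mem_sph hθ) hΩ, h2⟩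

theorem BdryEquiv.of_bdryNorm_eq_zero {g h : Euc d → ℝ}
    (hg : ∀ θ ∈ Sph d, AEStronglyMeasurable (g - h) (dirMeasure Ω θ))
    (h0 : bdryNorm Ω (g - h) = 0) : BdryEquiv Ω g h := by
  intro θ hθ
  have h1 : eLpNorm (g - h) 2 (dirMeasure Ω θ) = 0 :=
    le_antisymm ((le_iSup₂ (f := fun θ (_ : θ ∈ Sph d) => eLpNorm (g - h) 2 (dirMeasure Ω θ))
      θ hθ).trans h0.le) bot_le
  filter_upwards [(eLpNorm_eq_zero_iff (hg θ hθ) (by norm_num)).1 h1] with z hz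
  exact sub_eq_zero.1 hz

/-- The difference of two traces of `u` is a trace of `u - u = 0`, and the trace inequality makes it
vanish. -/
theorem IsOmniTrace.bdryEquiv (hΩ : IsOpen Ω) (hb : Bornology.IsBounded Ω) {u : H1 Ω}
    {g g' : Euc d → ℝ} (hg : IsOmniTrace u g) (hg' : IsOmniTrace u g') : BdryEquiv Ω g' g := by
  obtain ⟨R, hR⟩ := hb.subset_closedBall 0
  obtain ⟨M, hM⟩ := hg.1
  obtain ⟨M', hM'⟩ := hg'.1
  refine BdryEquiv.of_bdryNorm_eq_zero (fun θ hθ => (hM' θ hθ).1.1.sub (hM θ hθ).1.1) ?_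
  simp only [bdryNorm, ENNReal.iSup_eq_zero]
  intro θ hθ
  have hθ1 := norm_eq_of_mem_sph hθ
  obtain ⟨h, h1, h2⟩ := hg.exists_hasLineTraces hΩ hθ
  obtain ⟨h', h1', h2'⟩ := hg'.exists_hasLineTraces hΩ hθ
  have := (h1'.sub hθ1 hΩ h1).eLpNorm_le hθ1 hΩ hR ((hM' θ hθ).1.1.sub (hM θ hθ).1.1) (h2'.sub h2)
  rw [sub_self, enorm_zero_H1, mul_zero] at this
  exact le_antisymm this bot_le

/-- The trace inequality for `v - u`; its constant is uniform in `θ`, so it survives the supremum.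
-/
theorem IsOmniTrace.bdryNorm_sub_le (hΩ : IsOpen Ω) (hR : Ω ⊆ Metric.closedBall 0 R)
    {u v : H1 Ω} {g f : Euc d → ℝ} (hg : IsOmniTrace u g) (hf : IsContRep v f) :
    bdryNorm Ω (f - g) ≤ traceConst R ^ (1 / 2 : ℝ) * ‖v - u‖ₑ := by
  have hb : Bornology.IsBounded Ω := Metric.isBounded_closedBall.subset hR
  refine iSup₂_le fun θ hθ => ?_
  have hθ1 := norm_eq_of_mem_sph hθ
  obtain ⟨M, hM⟩ := hg.1
  obtain ⟨h, h1, h2⟩ := hg.exists_hasLineTraces hΩ hθ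
  exact ((hf.hasLineTraces hθ1 hΩ hb).sub hθ1 hΩ h1).eLpNorm_le hθ1 hΩ hR
    ((hf.aestronglyMeasurable hθ1 hΩ hb).sub (hM θ hθ).1.1) ((ae_eq_refl f).sub h2)

theorem IsOmniTrace.tendsto_bdryNorm (hΩ : IsOpen Ω) (hb : Bornology.IsBounded Ω)
    {u : H1 Ω} {g : Euc d → ℝ} (hg : IsOmniTrace u g) {v : ℕ → H1 Ω} {f : ℕ → Euc d → ℝ}
    (hf : ∀ n, IsContRep (v n) (f n)) (hv : Tendsto v atTop (𝓝 u)) :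
    Tendsto (fun n => bdryNorm Ω (f n - g)) atTop (𝓝 0) := by
  obtain ⟨R, hR⟩ := hb.subset_closedBall 0
  have h1 : Tendsto (fun n => ‖v n - u‖ₑ) atTop (𝓝 0) := by
    have h2 : Tendsto (fun n => v n - u) atTop (𝓝 0) := by
      simpa using hv.sub_const u
    simpa only [enorm_zero_H1] using h2.enorm
  have h3 := ENNReal.Tendsto.const_mul (a := traceConst R ^ (1 / 2 : ℝ)) h1
    (Or.inr (ENNReal.rpow_ne_top_of_nonneg (by norm_num) (traceConst_ne_top R)))
  rw [mul_zero] at h3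
  exact tendsto_of_tendsto_of_tendsto_of_le_of_le tendsto_const_nhds h3 (fun _ => bot_le)
    fun n => hg.bdryNorm_sub_le hΩ hR (hf n)

theorem bdryNorm_sub_le (Ω : Set (Euc d)) {f g h : Euc d → ℝ}
    (h1 : ∀ θ ∈ Sph d, AEStronglyMeasurable (f - g) (dirMeasure Ω θ))
    (h2 : ∀ θ ∈ Sph d, AEStronglyMeasurable (f - h) (dirMeasure Ω θ)) :
    bdryNorm Ω (h - g) ≤ bdryNorm Ω (f - g) + bdryNorm Ω (f - h) := by
  refine iSup₂_le fun θ hθ => ?_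
  have e : h - g = (f - g) - (f - h) := by abel
  rw [e]
  refine (eLpNorm_sub_le (h1 θ hθ) (h2 θ hθ) (by norm_num)).trans ?_
  exact add_le_add (le_iSup₂ (f := fun θ (_ : θ ∈ Sph d) => eLpNorm (f - g) 2 (dirMeasure Ω θ))
    θ hθ) (le_iSup₂ (f := fun θ (_ : θ ∈ Sph d) => eLpNorm (f - h) 2 (dirMeasure Ω θ)) θ hθ)

theorem BdryEquiv.of_tendsto (hΩ : IsOpen Ω) (hb : Bornology.IsBounded Ω) {g h : Euc d → ℝ}
    (hg : MemL2Bdry Ω g) (hh : MemL2Bdry Ω h) {v : ℕ → H1 Ω} {f : ℕ → Euc d → ℝ}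
    (hf : ∀ n, IsContRep (v n) (f n)) (h1 : Tendsto (fun n => bdryNorm Ω (f n - g)) atTop (𝓝 0))
    (h2 : Tendsto (fun n => bdryNorm Ω (f n - h)) atTop (𝓝 0)) : BdryEquiv Ω h g := by
  obtain ⟨M, hM⟩ := hg
  obtain ⟨M', hM'⟩ := hh
  have hfm : ∀ n, ∀ θ ∈ Sph d, AEStronglyMeasurable (f n) (dirMeasure Ω θ) := fun n θ hθ =>
    (hf n).aestronglyMeasurable (norm_eq_of_mem_sph hθ) hΩ hb
  refine BdryEquiv.of_bdryNorm_eq_zero (fun θ hθ => (hM' θ hθ).1.1.sub (hM θ hθ).1.1)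
    (le_antisymm ?_ bot_le)
  have h3 := h1.add h2
  rw [add_zero] at h3
  exact ge_of_tendsto' h3 fun n => bdryNorm_sub_le Ω
    (fun θ hθ => (hfm n θ hθ).sub (hM θ hθ).1.1) (fun θ hθ => (hfm n θ hθ).sub (hM' θ hθ).1.1)

/-! ### Existence of the trace -/

theorem IsGoodLine.exists_isChordRep {u : H1 Ω} {y : Hyp θ} (h : IsGoodLine u θ y)
    (hΩ : IsOpen Ω) (hc : IsChord Ω θ y α β) : ∃ f, IsChordRep (H1rep u) θ y α β f := by
  obtain ⟨c, hcs⟩ := h.exists_eq_primitive hΩ hc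
  exact ⟨_, (continuousOn_primitive hc.1.le (h.integrableOn_lineDerivRep hc) c).mono
    Ioc_subset_Icc_self, hcs.mono fun s hs => hs.symm⟩

/-- Meant for a fixed chord: `L` is its length, `C` the trace constant and `e n` the energy of the
error on the line. -/
theorem tendsto_of_enorm_sq_mul_le {a : ℕ → ℝ} {b : ℝ} {L C : ℝ≥0∞} {e : ℕ → ℝ≥0∞} (hL : L ≠ 0)
    (hL' : L ≠ ⊤) (hC : C ≠ ⊤) (he : Tendsto e atTop (𝓝 0))
    (h : ∀ n, ‖a n - b‖ₑ ^ 2 * L ≤ C * e n) : Tendsto a atTop (𝓝 b) := by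
  have h0 := ENNReal.Tendsto.const_mul (a := C) he (Or.inr hC)
  rw [mul_zero] at h0
  have h1 := ENNReal.Tendsto.mul_const (b := L⁻¹)
    (tendsto_of_tendsto_of_tendsto_of_le_of_le tendsto_const_nhds h0 (fun _ => bot_le) h)
    (Or.inr (ENNReal.inv_ne_top.2 hL))
  simp only [mul_assoc, ENNReal.mul_inv_cancel hL hL', mul_one, zero_mul] at h1
  have h2 := (ENNReal.continuous_rpow_const (y := (1 / 2 : ℝ))).tendsto 0 |>.comp h1
  have h3 : Tendsto (fun n => ‖a n - b‖ₑ) atTop (𝓝 0) := by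
    convert! h2 using 2
    · simp only [Function.comp]
      rw [← ENNReal.rpow_natCast, ← ENNReal.rpow_mul]
      norm_num
    · rw [ENNReal.zero_rpow_of_pos (by norm_num)]
  rw [tendsto_iff_edist_tendsto_0]
  simpa only [edist_eq_enorm_sub] using h3

theorem memL2Bdry_of_hasLineTraces (hΩ : IsOpen Ω) (hb : Bornology.IsBounded Ω) {u : H1 Ω}
    {g : Euc d → ℝ} (hm : ∀ θ ∈ Sph d, AEStronglyMeasurable g (dirMeasure Ω θ))
    (hg : ∀ θ ∈ Sph d, HasLineTraces Ω θ (H1rep u) g) : MemL2Bdry Ω g := by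
  obtain ⟨R, hR⟩ := hb.subset_closedBall 0
  set C := traceConst R ^ (1 / 2 : ℝ) * ‖u‖ₑ with hC
  have hCtop : C ≠ ⊤ := ENNReal.mul_ne_top
    (ENNReal.rpow_ne_top_of_nonneg (by norm_num) (traceConst_ne_top R)) enorm_ne_top
  have hle : ∀ θ ∈ Sph d, eLpNorm g 2 (dirMeasure Ω θ) ≤ C := fun θ hθ =>
    (hg θ hθ).eLpNorm_le (norm_eq_of_mem_sph hθ) hΩ hR (hm θ hθ) (ae_eq_refl g)
  refine ⟨(C ^ 2).toReal, fun θ hθ => ⟨⟨hm θ hθ, (hle θ hθ).trans_lt hCtop.lt_top⟩, ?_⟩⟩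
  rw [integral_eq_lintegral_of_nonneg_ae (Eventually.of_forall fun z => sq_nonneg _)
    ((hm θ hθ).pow 2)]
  refine ENNReal.toReal_mono (by finiteness) ?_
  have e : ∀ z, ENNReal.ofReal (g z ^ 2) = ‖g z‖ₑ ^ 2 := fun z => by
    rw [← Real.enorm_of_nonneg (sq_nonneg _), enorm_pow]
  simp only [e]
  rw [← eLpNorm_two_sq]
  gcongr
  exact hle θ hθ

theorem exists_isOmniTrace (hΩ : IsOpen Ω) (hb : Bornology.IsBounded Ω) {u : H1 Ω}
    (hu : u ∈ H1tilde Ω) : ∃ g, IsOmniTrace u g := by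
  obtain ⟨R, hR⟩ := hb.subset_closedBall 0
  -- Summability of the squared errors is what turns `H¹` convergence into convergence on almost
  -- every line, without a subsequence depending on `θ`.
  obtain ⟨ε, hε, hεsum⟩ := ENNReal.exists_pos_sum_of_countable (ε := 1) (by norm_num) ℕ
  have hex : ∀ n, ∃ v : H1 Ω, (∃ f, IsContRep v f) ∧ ‖v - u‖ₑ ^ 2 < ε n := by
    intro n
    have ho : IsOpen {v : H1 Ω | ‖v - u‖ₑ ^ 2 < ε n} :=
      isOpen_lt (by fun_prop) continuous_const
    obtain ⟨v, hv1, hv2⟩ := mem_closure_iff.1 hu _ ho (by simp [enorm_zero_H1, hε n])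
    exact ⟨v, hv2, hv1⟩
  choose v hv hvε using hex
  choose f hf using hv
  -- The definition does not involve `θ`. The indicator makes each term Borel, as `f n` is
  -- controlled only on `Ω̄`; where the sequence diverges the value is a default one, which does no
  -- harm.
  let g : Euc d → ℝ := fun z => limUnder atTop fun n => (frontier Ω).indicator (f n) z
  have hgm : StronglyMeasurable g := by
    refine StronglyMeasurable.limUnder fun n => Measurable.stronglyMeasurable ?_
    classical
    have := ContinuousOn.measurable_piecewise (s := frontier Ω) (f := f n) (g := 0)
      ((hf n).1.mono frontier_subset_closure) continuousOn_const isClosed_frontier.measurableSet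
    rwa [piecewise_eq_indicator] at this
  have htr : ∀ θ ∈ Sph d, HasLineTraces Ω θ (H1rep u) g := by
    intro θ hθ
    have hθ1 := norm_eq_of_mem_sph hθ
    have hsum : ∀ᵐ y : Hyp θ ∂(hypVolume θ),
        ∑' n, ∫⁻ s in slice Ω θ y, energy (v n - u) (s • θ + (y : Euc d)) < ⊤ := by
      have hm : ∀ n, AEMeasurable (fun y : Hyp θ =>
          ∫⁻ s in slice Ω θ y, energy (v n - u) (s • θ + (y : Euc d))) (hypVolume θ) :=
        fun n => aemeasurable_lintegral_lines hθ1 hΩ (aemeasurable_energy _)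
      refine ae_lt_top' (AEMeasurable.tsum hm) ?_
      rw [lintegral_tsum hm]
      refine ne_of_lt ((ENNReal.tsum_le_tsum fun n => ?_).trans_lt
        (hεsum.trans (by norm_num : (1 : ℝ≥0∞) < ⊤)))
      rw [← lintegral_lines hθ1 hΩ (aemeasurable_energy _), lintegral_energy]
      exact (hvε n).le
    have hgood : ∀ᵐ y : Hyp θ ∂(hypVolume θ), ∀ n, IsGoodLine (v n - u) θ y :=
      ae_all_iff.2 fun n => ae_isGoodLine hθ1 hΩ hb (v n - u)
    have hsub : ∀ᵐ y : Hyp θ ∂(hypVolume θ), ∀ n, ∀ᵐ s ∂(volume.restrict (slice Ω θ y)),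
        H1rep (v n - u) (s • θ + (y : Euc d))
          = f n (s • θ + (y : Euc d)) - H1rep u (s • θ + (y : Euc d)) := by
      rw [ae_all_iff]
      intro n
      refine ae_lines hθ1 hΩ (P := fun x => H1rep (v n - u) x = f n x - H1rep u x) ?_
      filter_upwards [H1rep_sub (v n) u, (hf n).2] with x h1 h2
      rw [h1, h2]
    filter_upwards [hsum, hgood, ae_isGoodLine hθ1 hΩ hb u, hsub] with y hy1 hy2 hy3 hy4 α β hc
    obtain ⟨F, hF⟩ := hy3.exists_isChordRep hΩ hc
    refine ⟨F, hF, ?_⟩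
    have hfr := hc.mem_frontier hθ1 hΩ hb
    refine Tendsto.limUnder_eq ?_
    simp only [indicator_of_mem hfr]
    refine tendsto_of_enorm_sq_mul_le (L := ENNReal.ofReal (β - α)) (by simpa using hc.1)
      ENNReal.ofReal_ne_top (traceConst_ne_top R)
      (ENNReal.tendsto_atTop_zero_of_tsum_ne_top hy1.ne) fun n => ?_
    -- The chord inequality for `v n - u`, whose continuous representative on the chord is `f n -
    -- F`.
    refine ((hy2 n).trace_le hθ1 hΩ hR hc
      (f := fun s => f n (s • θ + (y : Euc d)) - F s) ⟨?_, ?_⟩).trans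
      (by gcongr; exact hc.2.1)
    · refine ContinuousOn.sub ((hf n).1.comp (continuous_line θ y).continuousOn
        fun s hs => ?_) hF.1
      rcases eq_or_lt_of_le hs.2 with e | e
      · rw [e]
        exact frontier_subset_closure hfr
      · exact subset_closure (hc.2.1 ⟨hs.1, e⟩)
    · filter_upwards [hF.2, ae_restrict_of_ae_restrict_of_subset hc.2.1 (hy4 n)] with s a1 a2
      rw [a2, a1]
  have hm : ∀ θ ∈ Sph d, AEStronglyMeasurable g (dirMeasure Ω θ) := fun θ _ =>
    hgm.aestronglyMeasurable
  exact ⟨g, memL2Bdry_of_hasLineTraces hΩ hb hm htr, fun θ hθ =>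
    ⟨g, (htr θ hθ).isDirTrace (norm_eq_of_mem_sph hθ) hΩ hb, ae_eq_refl g⟩⟩

/-! ### First inclusion: limits of test functions have zero trace -/

theorem IsTestFunction.eq_zero_of_mem_frontier (hΩ : IsOpen Ω) {φ : Euc d → ℝ}
    (hφ : IsTestFunction Ω φ) {z : Euc d} (hz : z ∈ frontier Ω) : φ z = 0 :=
  image_eq_zero_of_notMem_tsupport fun h => (hΩ.frontier_eq ▸ hz).2 (hφ.supp h)

/-- Test functions are continuous on `Ω̄` and vanish on `∂Ω`, so both `tr(u)` and `0` are limits of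
their boundary values. -/
theorem H10_subset_H1tr0 (hΩ : IsOpen Ω) (hb : Bornology.IsBounded Ω) : H10 Ω ⊆ H1tr0 Ω := by
  intro u hu
  obtain ⟨v, hv, hvu⟩ := mem_closure_iff_seq_limit.1 hu
  choose φ hφ hφv using hv
  have hf : ∀ n, IsContRep (v n) (φ n) := fun n => ⟨(hφ n).smooth.continuous.continuousOn, hφv n⟩
  obtain ⟨g, hg⟩ := exists_isOmniTrace hΩ hb (u := u)
    (mem_closure_iff_seq_limit.2 ⟨v, fun n => ⟨φ n, hf n⟩, hvu⟩)
  refine ⟨g, hg, fun θ hθ => ?_⟩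
  have h0 : ∀ n, bdryNorm Ω (φ n - 0) = 0 := by
    intro n
    simp only [bdryNorm, ENNReal.iSup_eq_zero]
    intro θ hθ
    have hθ1 := norm_eq_of_mem_sph hθ
    rw [eLpNorm_congr_ae (g := 0), eLpNorm_zero]
    filter_upwards [ae_frontier_dirMeasure hθ1 hΩ hb] with z hz
    simp [(hφ n).eq_zero_of_mem_frontier hΩ hz]
  have hz : MemL2Bdry Ω (0 : Euc d → ℝ) := ⟨0, fun θ _ => ⟨MemLp.zero, by simp⟩⟩
  exact (BdryEquiv.of_tendsto hΩ hb hg.1 hz hf (hg.tendsto_bdryNorm hΩ hb hf hvu)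
    (by simp only [h0]; exact tendsto_const_nhds) θ hθ).symm

end

section

variable {d : ℕ} {θ : Euc d} {Ω : Set (Euc d)} {α β R : ℝ}

/-! ### Extension by zero of functions with zero trace -/

theorem HasLineTraces.ae_right_eq_zero (hθ : ‖θ‖ = 1) (hΩ : IsOpen Ω)
    (hb : Bornology.IsBounded Ω) {u h : Euc d → ℝ} (hh : HasLineTraces Ω θ u h)
    (h0 : h =ᵐ[dirMeasure Ω θ] 0) :
    ∀ᵐ y : Hyp θ ∂(hypVolume θ), ∀ α β, IsChord Ω θ y α β →
      ∃ f, IsChordRep u θ y α β f ∧ f β = 0 := by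
  have hΦ := aemeasurable_Phi (θ := θ) hΩ hb hθ
  have h1 : ∀ᵐ x ∂(volume.restrict Ω), h (Phi Ω θ x) = 0 := ae_of_ae_map hΦ h0
  filter_upwards [hh, ae_lines hθ hΩ h1] with y hy hy1 α β hc
  obtain ⟨f, hf, hfβ⟩ := hy α β hc
  refine ⟨f, hf, ?_⟩
  have h2 := (ae_restrict_of_ae_restrict_of_subset hc.2.1 hy1).and
    (ae_restrict_mem measurableSet_Ioo)
  have : (ae (volume.restrict (Ioo α β))).NeBot := by
    rw [ae_neBot, Ne, Measure.restrict_eq_zero]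
    simpa using hc.1
  -- `h ∘ Φ_θ` vanishes a.e. on a chord of positive length and is constant there, so a single good
  -- `s` gives the value at `β`.
  obtain ⟨s, hs, hsm⟩ := h2.exists
  rw [hc.Phi_eq hθ hb hsm] at hs
  rw [← hfβ, hs]

theorem HasLineTraces.ae_left_eq_zero (hθ : ‖θ‖ = 1) (hΩ : IsOpen Ω)
    (hb : Bornology.IsBounded Ω) {u h : Euc d → ℝ} (hh : HasLineTraces Ω (-θ) u h)
    (h0 : h =ᵐ[dirMeasure Ω (-θ)] 0) :
    ∀ᵐ y : Hyp θ ∂(hypVolume θ), ∀ α β, IsChord Ω θ y α β →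
      ∃ f, ContinuousOn f (Ioc (-β) (-α)) ∧
        (∀ᵐ s ∂(volume.restrict (Ioo (-β) (-α))), f s = u ((-s) • θ + (y : Euc d))) ∧
        f (-α) = 0 := by
  have h1 := hh.ae_right_eq_zero (by rwa [norm_neg]) hΩ hb h0
  -- Quantifying over `y` turns the property into a predicate of the ambient point, which can be
  -- transported from `H_{-θ}` to `H_θ`.
  have h2 := ae_hyp_neg (P := fun x => ∀ y : Hyp (-θ), (y : Euc d) = x →
    ∀ α β, IsChord Ω (-θ) y α β → ∃ f, IsChordRep u (-θ) y α β f ∧ f β = 0) (θ := θ) (by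
      filter_upwards [h1] with y hy y' hyy'
      rwa [Subtype.ext hyy'])
  filter_upwards [h2] with y hy α β hc
  obtain ⟨f, hf, hf0⟩ := hy ⟨y, by rw [Hyp_neg]; exact y.2⟩ rfl _ _ (hc.neg rfl)
  refine ⟨f, hf.1, ?_, hf0⟩
  filter_upwards [hf.2] with s hs
  rw [hs]
  simp

/-- The constant `c` is the value at `α` of the primitive; after reflection it is compared with `f`
at the right end `-α`. -/
theorem eq_zero_of_left_eq_zero {c : ℝ} {w u f : ℝ → ℝ} (hαβ : α < β)
    (hw : IntegrableOn w (Ioo α β))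
    (hu : ∀ᵐ s ∂(volume.restrict (Ioo α β)), u s = c + ∫ t in α..s, w t)
    (hf : ContinuousOn f (Ioc (-β) (-α)))
    (hfu : ∀ᵐ s ∂(volume.restrict (Ioo (-β) (-α))), f s = u (-s)) (h0 : f (-α) = 0) : c = 0 := by
  have hc : ContinuousOn (fun s => c + ∫ t in α..(-s), w t) (Ioc (-β) (-α)) :=
    (continuousOn_primitive hαβ.le hw c).comp continuousOn_neg
      fun s hs => ⟨by linarith [hs.2], by linarith [hs.1]⟩
  have h1 : ∀ᵐ s ∂(volume.restrict (Ioo (-β) (-α))), f s = c + ∫ t in α..(-s), w t := by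
    rw [ae_restrict_iff' measurableSet_Ioo] at hu hfu ⊢
    have hu' := (Measure.measurePreserving_neg (volume : Measure ℝ)).quasiMeasurePreserving.ae hu
    filter_upwards [hu', hfu] with s a1 a2 hs
    rw [a2 hs, a1 ⟨by linarith [hs.2], by linarith [hs.1]⟩]
  have h2 := eqOn_Ioc_of_ae_Ioo hf hc h1 (right_mem_Ioc.2 (neg_lt_neg hαβ))
  simpa [h0] using h2.symm

/-- The gradient of an element of `H¹_{tr,0}(Ω)` can be tested against all the test functions of
the space. -/
theorem integral_mul_fderiv_of_mem_H1tr0 (hΩ : IsOpen Ω) (hb : Bornology.IsBounded Ω)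
    {u : H1 Ω} (hu : u ∈ H1tr0 Ω) {φ : Euc d → ℝ} (hφ : IsTestFunction univ φ)
    (hθ : θ ∈ Sph d) :
    ∫ x in Ω, H1rep u x * fderiv ℝ φ x θ = - ∫ x in Ω, inner ℝ (H1grad u x) θ * φ x := by
  obtain ⟨g, hg, hg0⟩ := hu
  have hθ1 := norm_eq_of_mem_sph hθ
  have hθ' : -θ ∈ Sph d := by simpa using hθ1
  obtain ⟨h, hh, hhg⟩ := hg.exists_hasLineTraces hΩ hθ
  obtain ⟨h', hh', hhg'⟩ := hg.exists_hasLineTraces hΩ hθ'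
  have m1 : MemLp φ 2 (volume : Measure (Euc d)) :=
    hφ.smooth.continuous.memLp_of_hasCompactSupport hφ.compact
  have m2 : MemLp (fun x => fderiv ℝ φ x θ) 2 (volume : Measure (Euc d)) :=
    ((hφ.smooth.continuous_fderiv (by simp)).clm_apply
      continuous_const).memLp_of_hasCompactSupport (hφ.compact.fderiv_apply ℝ θ)
  have i1 : Integrable (fun x => H1rep u x * fderiv ℝ φ x θ) (volume.restrict Ω) :=
    (memLp_H1rep u).integrable_mul (m2.restrict Ω)
  have i2 : Integrable (fun x => inner ℝ (H1grad u x) θ * φ x) (volume.restrict Ω) :=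
    ((memLp_H1grad u).inner_const θ).integrable_mul (m1.restrict Ω)
  suffices hs : ∫ x in Ω, (H1rep u x * fderiv ℝ φ x θ + inner ℝ (H1grad u x) θ * φ x) = 0 by
    rw [integral_add i1 i2] at hs
    linarith
  refine (integral_lines hθ1 hΩ (i1.add i2)).2.trans ?_
  refine integral_eq_zero_of_ae ?_
  filter_upwards [hh.ae_right_eq_zero hθ1 hΩ hb (hhg.trans (hg0 θ hθ)),
    hh'.ae_left_eq_zero hθ1 hΩ hb (hhg'.trans (hg0 _ hθ')), ae_isGoodLine hθ1 hΩ hb u,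
    memLp_lines hθ1 hΩ (m1.restrict Ω), memLp_lines hθ1 hΩ (m2.restrict Ω)]
    with y hr hl hgood n1 n2
  simp only [Pi.add_apply, Pi.zero_apply]
  refine integral_slice_eq_zero hθ1 hΩ hb
    ((hgood.memLp.integrable_mul n2).add (hgood.memLp_lineDerivRep.integrable_mul n1))
    fun α β hc => ?_
  have hw := hgood.integrableOn_lineDerivRep hc
  obtain ⟨c, hcs⟩ := hgood.exists_eq_primitive hΩ hc
  obtain ⟨f, hf, hfβ⟩ := hr α β hc
  obtain ⟨f', hf'1, hf'2, hf'α⟩ := hl α β hc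
  have hc0 : c = 0 := eq_zero_of_left_eq_zero (u := fun s => H1rep u (s • θ + (y : Euc d)))
    hc.1 hw hcs hf'1 hf'2 hf'α
  have hβ0 : c + ∫ t in α..β, lineDerivRep u θ y t = 0 := by
    have := eqOn_Ioc_of_ae_Ioo hf.1
      ((continuousOn_primitive hc.1.le hw c).mono Ioc_subset_Icc_self)
      (by filter_upwards [hf.2, hcs] with s a1 a2; rw [a1, a2]) (right_mem_Ioc.2 hc.1)
    rw [hfβ] at this
    exact this.symm
  have hψ : ContDiff ℝ ∞ fun s : ℝ => φ (s • θ + (y : Euc d)) :=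
    hφ.smooth.comp ((contDiff_id.smul contDiff_const).add contDiff_const)
  have hderiv : ∀ s, deriv (fun s : ℝ => φ (s • θ + (y : Euc d))) s
      = fderiv ℝ φ (s • θ + (y : Euc d)) θ := by
    intro s
    have h1 : HasDerivAt (fun s : ℝ => s • θ + (y : Euc d)) θ s := by
      simpa using ((hasDerivAt_id s).smul_const θ).add_const (y : Euc d)
    exact ((((hφ.smooth.differentiable (by simp)) _).hasFDerivAt).comp_hasDerivAt s h1).deriv
  -- `φ` need not vanish at the ends of the chord; the boundary terms drop because `u` does.
  have key := integral_primitive_mul_deriv hc.1.le hw c hψ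
  rw [hβ0, hc0] at key
  simp only [hderiv, zero_mul, sub_zero, zero_sub] at key
  have j1 : IntegrableOn (fun s : ℝ => H1rep u (s • θ + (y : Euc d))
      * fderiv ℝ φ (s • θ + (y : Euc d)) θ) (Ioo α β) :=
    IntegrableOn.mono_set (hgood.memLp.integrable_mul n2) hc.2.1
  have j2 : IntegrableOn (fun s : ℝ => lineDerivRep u θ y s * φ (s • θ + (y : Euc d)))
      (Ioo α β) :=
    IntegrableOn.mono_set (hgood.memLp_lineDerivRep.integrable_mul n1) hc.2.1
  have e1 : ∫ s in Ioo α β, H1rep u (s • θ + (y : Euc d)) * fderiv ℝ φ (s • θ + (y : Euc d)) θ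
      = ∫ s in Ioo α β, (0 + ∫ t in α..s, lineDerivRep u θ y t)
        * fderiv ℝ φ (s • θ + (y : Euc d)) θ := by
    refine integral_congr_ae ?_
    filter_upwards [hcs] with s hs
    rw [hs, hc0]
  refine (integral_add j1 j2).trans ?_
  rw [e1, key]
  ring

theorem integral_mul_fderiv_of_mem_H1tr0' (hΩ : IsOpen Ω) (hb : Bornology.IsBounded Ω)
    {u : H1 Ω} (hu : u ∈ H1tr0 Ω) {φ : Euc d → ℝ} (hφ : IsTestFunction univ φ) (v : Euc d) :
    ∫ x in Ω, H1rep u x * fderiv ℝ φ x v = - ∫ x in Ω, inner ℝ (H1grad u x) v * φ x := by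
  rcases eq_or_ne v 0 with rfl | hv
  · simp
  have hθ : ‖v‖⁻¹ • v ∈ Sph d := by
    simp [norm_smul, inv_mul_cancel₀ (norm_ne_zero_iff.2 hv)]
  have h1 := integral_mul_fderiv_of_mem_H1tr0 hΩ hb hu hφ hθ
  simp only [map_smul, smul_eq_mul, real_inner_smul_right] at h1
  have e1 : ∀ x, H1rep u x * (‖v‖⁻¹ * fderiv ℝ φ x v) = ‖v‖⁻¹ * (H1rep u x * fderiv ℝ φ x v) :=
    fun x => by ring
  simp only [e1, mul_assoc, integral_const_mul] at h1
  rw [← mul_neg] at h1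
  exact mul_left_cancel₀ (inv_ne_zero (norm_ne_zero_iff.2 hv)) h1

end

section

/-! ### Mollification -/

theorem IsTestFunction.translate {E : Type*} [NormedAddCommGroup E] [NormedSpace ℝ E] {φ : E → ℝ}
    (hφ : IsTestFunction univ φ) (t : E) : IsTestFunction univ fun x => φ (x + t) :=
  ⟨hφ.smooth.comp (contDiff_id.add contDiff_const),
    hφ.compact.comp_homeomorph (Homeomorph.addRight t), subset_univ _⟩

section Mollify

variable {E F : Type*} [NormedAddCommGroup E] [InnerProductSpace ℝ E] [FiniteDimensional ℝ E]
  [MeasurableSpace E] [BorelSpace E] [NormedAddCommGroup F]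

/-- Translations are continuous in `L²`. -/
theorem tendsto_eLpNorm_translate {h : E → F} (hh : MemLp h 2 (volume : Measure E)) :
    Tendsto (fun t : E => eLpNorm (fun x => h (x - t) - h x) 2 volume) (𝓝 0) (𝓝 0) := by
  let T : C(E × E, E) := ⟨fun p => p.2 - p.1, by fun_prop⟩
  have hm : ∀ t : E, MeasurePreserving (T.curry t) volume volume := fun t =>
    measurePreserving_sub_right volume t
  have hc : Continuous fun t : E => Lp.compMeasurePreserving (T.curry t) (hm t) (hh.toLp h) :=
    continuous_const.compMeasurePreservingLp T.curry.continuous hm (by norm_num)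
  have h1 := (hc.tendsto 0).sub_const (hh.toLp h)
  have h2 : Lp.compMeasurePreserving (T.curry 0) (hm 0) (hh.toLp h) - hh.toLp h = 0 := by
    rw [sub_eq_zero]
    refine Lp.ext ((Lp.coeFn_compMeasurePreserving _ (hm 0)).trans ?_)
    refine Eventually.of_forall fun x => ?_
    simp [T]
  rw [h2] at h1
  have h3 := h1.enorm
  simp only [enorm_zero] at h3
  refine h3.congr fun t => ?_
  rw [Lp.enorm_def]
  refine eLpNorm_congr_ae ?_
  filter_upwards [Lp.coeFn_sub (Lp.compMeasurePreserving (T.curry t) (hm t) (hh.toLp h))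
    (hh.toLp h), Lp.coeFn_compMeasurePreserving (hh.toLp h) (hm t), hh.coeFn_toLp,
    (hm t).quasiMeasurePreserving.ae hh.coeFn_toLp] with x a1 a2 a3 a4
  rw [a1, Pi.sub_apply, a2, a3]
  exact congrArg (· - h x) a4

variable [NormedSpace ℝ F]

/-- The average of the translates of `h` with the weight `ρ`. -/
def mollify (ρ : E → ℝ) (h : E → F) (x : E) : F := ∫ t, ρ t • h (x - t)

theorem continuous_mollify {ρ : E → ℝ} (hρ : Continuous ρ) (hc : HasCompactSupport ρ) {h : E → F}
    (hh : Integrable h) : Continuous (mollify ρ h) :=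
  hc.continuous_convolution_left (ContinuousLinearMap.lsmul ℝ ℝ) hρ hh.locallyIntegrable

theorem integrable_mollify_integrand {ρ : E → ℝ} (hρ : Continuous ρ) (hc : HasCompactSupport ρ)
    {h : E → F} (hh : Integrable h) (x : E) : Integrable fun t => ρ t • h (x - t) := by
  obtain ⟨C, hC⟩ := hc.exists_bound_of_continuous hρ
  exact (hh.comp_sub_left x).bdd_smul C hρ.aestronglyMeasurable (Eventually.of_forall hC)

/-- `mollify ρ h - h` is the average of `h(· - t) - h` for the probability measure `ρ dt`.
Cauchy–Schwarz puts the square inside the average, and Tonelli reduces to the `L²` modulus of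
continuity on the support of `ρ`. -/
theorem eLpNorm_mollify_sub_le [CompleteSpace F] {ρ : E → ℝ} (hρ : Continuous ρ)
    (hc : HasCompactSupport ρ) (hρ0 : ∀ t, 0 ≤ ρ t) (hρ1 : ∫ t, ρ t = 1) {h : E → F}
    (hh : Integrable h) {ε : ℝ≥0∞}
    (hε : ∀ t, ρ t ≠ 0 → eLpNorm (fun x => h (x - t) - h x) 2 volume ≤ ε) :
    eLpNorm (fun x => mollify ρ h x - h x) 2 volume ^ 2 ≤ ε ^ 2 := by
  have hρi : Integrable ρ (volume : Measure E) := hρ.integrable_of_hasCompactSupport hc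
  have hρe : Measurable fun t => ‖ρ t‖ₑ := hρ.measurable.enorm
  have hρ1' : ∫⁻ t, ‖ρ t‖ₑ = 1 := by
    have := ofReal_integral_eq_lintegral_ofReal hρi (Eventually.of_forall hρ0)
    rw [hρ1, ENNReal.ofReal_one] at this
    rw [this]
    exact lintegral_congr fun t => (Real.enorm_of_nonneg (hρ0 t))
  have hq := quasiMeasurePreserving_sub_of_right_invariant (volume : Measure E) (volume : Measure E)
  have hjoint : AEStronglyMeasurable (fun p : E × E => h (p.1 - p.2) - h p.1)
      ((volume : Measure E).prod volume) :=
    (hh.1.comp_quasiMeasurePreserving hq).sub hh.1.comp_fst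
  have hpt : ∀ x, ‖mollify ρ h x - h x‖ₑ ^ 2 ≤ ∫⁻ t, ‖ρ t‖ₑ * ‖h (x - t) - h x‖ₑ ^ 2 := by
    intro x
    have e1 : mollify ρ h x - h x = ∫ t, ρ t • (h (x - t) - h x) := by
      simp only [smul_sub]
      rw [integral_sub (integrable_mollify_integrand hρ hc hh x) (hρi.smul_const _),
        integral_smul_const, hρ1, one_smul, mollify]
    have hxm : AEMeasurable (fun t => ‖h (x - t) - h x‖ₑ) volume :=
      ((hh.comp_sub_left x).1.sub aestronglyMeasurable_const).enorm
    have e2 : ∫⁻ t, ‖ρ t • (h (x - t) - h x)‖ₑ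
        = ∫⁻ t, ‖h (x - t) - h x‖ₑ ∂(volume.withDensity fun t => ‖ρ t‖ₑ) := by
      rw [lintegral_withDensity_eq_lintegral_mul₀ hρe.aemeasurable hxm]
      exact lintegral_congr fun t => enorm_smul _ _
    have hu : (volume.withDensity fun t => ‖ρ t‖ₑ) univ = 1 := by
      rw [withDensity_apply _ MeasurableSet.univ, setLIntegral_univ, hρ1']
    calc ‖mollify ρ h x - h x‖ₑ ^ 2
        ≤ (∫⁻ t, ‖h (x - t) - h x‖ₑ ∂(volume.withDensity fun t => ‖ρ t‖ₑ)) ^ 2 := by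
          rw [e1, ← e2]
          gcongr
          exact enorm_integral_le_lintegral_enorm _
      _ ≤ ∫⁻ t, ‖h (x - t) - h x‖ₑ ^ 2 ∂(volume.withDensity fun t => ‖ρ t‖ₑ) := by
          have := sq_lintegral_le (hxm.mono_ac (withDensity_absolutelyContinuous volume
            fun t => ‖ρ t‖ₑ))
          rwa [hu, one_mul] at this
      _ = _ := lintegral_withDensity_eq_lintegral_mul₀ hρe.aemeasurable (hxm.pow_const 2)
  rw [eLpNorm_two_sq]
  calc ∫⁻ x, ‖mollify ρ h x - h x‖ₑ ^ 2
      ≤ ∫⁻ x, ∫⁻ t, ‖ρ t‖ₑ * ‖h (x - t) - h x‖ₑ ^ 2 := lintegral_mono hpt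
    _ = ∫⁻ t, ∫⁻ x, ‖ρ t‖ₑ * ‖h (x - t) - h x‖ₑ ^ 2 := by
        refine lintegral_lintegral_swap ?_
        exact (hρe.comp measurable_snd).aemeasurable.mul (hjoint.enorm.pow_const 2)
    _ ≤ ∫⁻ t, ‖ρ t‖ₑ * ε ^ 2 := by
        refine lintegral_mono fun t => ?_
        rw [lintegral_const_mul' _ _ enorm_ne_top, ← eLpNorm_two_sq]
        rcases eq_or_ne (ρ t) 0 with h0 | h0
        · simp [h0]
        · gcongr
          exact hε t h0
    _ = ε ^ 2 := by
        rw [lintegral_mul_const _ hρe, hρ1', one_mul]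

/-- The same `ρ` must serve the function and its gradient, so that one mollification is the gradient
of the other. -/
theorem exists_mollifier [CompleteSpace F] {F' : Type*} [NormedAddCommGroup F'] [NormedSpace ℝ F']
    [CompleteSpace F'] {h : E → F} {h' : E → F'} (hh : Integrable h) (hh2 : MemLp h 2 volume)
    (hh' : Integrable h') (hh2' : MemLp h' 2 volume) {ε : ℝ≥0∞} (hε : 0 < ε) :
    ∃ ρ : E → ℝ, Continuous ρ ∧ HasCompactSupport ρ ∧
      eLpNorm (fun x => mollify ρ h x - h x) 2 volume ^ 2 ≤ ε ^ 2 ∧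
      eLpNorm (fun x => mollify ρ h' x - h' x) 2 volume ^ 2 ≤ ε ^ 2 := by
  have h1 := (tendsto_eLpNorm_translate hh2).eventually (ge_mem_nhds hε)
  have h2 := (tendsto_eLpNorm_translate hh2').eventually (ge_mem_nhds hε)
  obtain ⟨δ, hδ, hball⟩ := Metric.eventually_nhds_iff_ball.1 (h1.and h2)
  let B : ContDiffBump (0 : E) := ⟨δ / 2, δ, by linarith, by linarith⟩
  have hB : ∀ t, B.normed volume t ≠ 0 → t ∈ Metric.ball (0 : E) δ := by
    intro t ht
    have : t ∈ Function.support (B.normed volume) := ht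
    rwa [B.support_normed_eq] at this
  have hcont : Continuous (B.normed (volume : Measure E)) := B.continuous_normed
  exact ⟨B.normed volume, hcont, B.hasCompactSupport_normed,
    eLpNorm_mollify_sub_le hcont B.hasCompactSupport_normed B.nonneg_normed B.integral_normed hh
      fun t ht => (hball t (hB t ht)).1,
    eLpNorm_mollify_sub_le hcont B.hasCompactSupport_normed B.nonneg_normed B.integral_normed hh'
      fun t ht => (hball t (hB t ht)).2⟩

theorem integral_mollify_mul {ρ : E → ℝ} (hρ : Continuous ρ) (hc : HasCompactSupport ρ)
    {h ψ : E → ℝ} (hh : Integrable h) (hψ : Continuous ψ) (hψc : HasCompactSupport ψ) :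
    ∫ x, mollify ρ h x * ψ x = ∫ t, ρ t * ∫ x, h x * ψ (x + t) := by
  obtain ⟨C, hC⟩ := hψc.exists_bound_of_continuous hψ
  have hρi : Integrable ρ (volume : Measure E) := hρ.integrable_of_hasCompactSupport hc
  have hi : Integrable (fun p : E × E => ρ p.2 * h (p.1 - p.2) * ψ p.1)
      ((volume : Measure E).prod volume) :=
    (hρi.convolution_integrand (ContinuousLinearMap.mul ℝ ℝ) hh).mul_bdd
      (hψ.comp continuous_fst).aestronglyMeasurable (Eventually.of_forall fun p => hC p.1)
  have e1 : ∀ x, mollify ρ h x * ψ x = ∫ t, ρ t * h (x - t) * ψ x := fun x => by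
    rw [mollify, ← integral_mul_const]; rfl
  simp only [e1]
  rw [integral_integral_swap hi]
  refine integral_congr_ae (Eventually.of_forall fun t => ?_)
  simp only [mul_assoc, integral_const_mul]
  rw [← integral_add_right_eq_self (fun x => h (x - t) * ψ x) t]
  simp only [add_sub_cancel_right]

/-- Mollification commutes with weak derivatives on the whole space. -/
theorem IsWeakDirDeriv.mollify {ρ : E → ℝ} (hρ : Continuous ρ) (hc : HasCompactSupport ρ)
    {u w : E → ℝ} (hu : Integrable u) (hw : Integrable w) {v : E}
    (h : ∀ φ, IsTestFunction univ φ → ∫ x, u x * fderiv ℝ φ x v = - ∫ x, w x * φ x)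
    {φ : E → ℝ} (hφ : IsTestFunction univ φ) :
    ∫ x, mollify ρ u x * fderiv ℝ φ x v = - ∫ x, mollify ρ w x * φ x := by
  have c1 : Continuous fun x => fderiv ℝ φ x v :=
    (hφ.smooth.continuous_fderiv (by simp)).clm_apply continuous_const
  rw [integral_mollify_mul hρ hc hu c1 (hφ.compact.fderiv_apply ℝ v),
    integral_mollify_mul hρ hc hw hφ.smooth.continuous hφ.compact, ← integral_neg]
  refine integral_congr_ae (Eventually.of_forall fun t => ?_)
  have h1 := h _ (hφ.translate t)
  simp only [fderiv_comp_add_right] at h1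
  simp only [h1, mul_neg]

end Mollify

variable {d : ℕ} {Ω : Set (Euc d)}

theorem inner_mollify {ρ : Euc d → ℝ} (hρ : Continuous ρ) (hc : HasCompactSupport ρ)
    {G : Euc d → Euc d} (hG : Integrable G) (x v : Euc d) :
    inner ℝ (mollify ρ G x) v = mollify ρ (fun x => inner ℝ (G x) v) x := by
  have h1 := integral_inner (𝕜 := ℝ) (integrable_mollify_integrand hρ hc hG x) v
  rw [real_inner_comm, mollify, ← h1, mollify]
  refine integral_congr_ae (Eventually.of_forall fun t => ?_)
  simp only [real_inner_smul_right, smul_eq_mul, real_inner_comm]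

/-! ### Approximation by functions continuous up to the boundary -/

theorem memLp_of_eLpNorm_sub_sq_le {X F : Type*} [MeasurableSpace X] {μ : Measure X}
    [NormedAddCommGroup F] {f g : X → F} {c : ℝ≥0∞} (hf : AEStronglyMeasurable f μ)
    (hg : MemLp g 2 μ) (hc : c ≠ ⊤) (h : eLpNorm (fun x => f x - g x) 2 μ ^ 2 ≤ c) :
    MemLp f 2 μ := by
  have h1 : MemLp (fun x => f x - g x) 2 μ :=
    ⟨hf.sub hg.1, lt_top_iff_ne_top.2 fun h' => hc (by simpa [h'] using h)⟩
  exact (h1.add hg).ae_eq (Eventually.of_forall fun x => sub_add_cancel _ _)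

theorem exists_H1_of_isWeakGradient {f : Euc d → ℝ} {G : Euc d → Euc d}
    (hf : MemLp f 2 (volume.restrict Ω)) (hG : MemLp G 2 (volume.restrict Ω))
    (h : IsWeakGradient Ω f G) :
    ∃ v : H1 Ω, H1rep v =ᵐ[volume.restrict Ω] f ∧ H1grad v =ᵐ[volume.restrict Ω] G := by
  refine ⟨⟨WithLp.toLp 2 (hf.toLp f, hG.toLp G), fun v φ hφ => ?_⟩, hf.coeFn_toLp, hG.coeFn_toLp⟩
  refine Eq.trans (integral_congr_ae ?_) ((h v φ hφ).trans (congrArg Neg.neg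
    (integral_congr_ae ?_)))
  · filter_upwards [hf.coeFn_toLp] with x hx
    exact congrArg (· * _) hx
  · filter_upwards [hG.coeFn_toLp] with x hx
    exact congrArg (fun z => inner ℝ z v * φ x) hx.symm

theorem H1grad_sub (u v : H1 Ω) :
    H1grad (u - v) =ᵐ[volume.restrict Ω] fun x => H1grad u x - H1grad v x :=
  Lp.coeFn_sub u.1.snd v.1.snd

theorem enorm_sub_sq_le {u v : H1 Ω} (hΩ : IsOpen Ω) {f : Euc d → ℝ} {G : Euc d → Euc d}
    (hf : AEStronglyMeasurable (fun x => f x - Ω.indicator (H1rep u) x) volume)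
    (hv : H1rep v =ᵐ[volume.restrict Ω] f) (hvG : H1grad v =ᵐ[volume.restrict Ω] G) :
    ‖u - v‖ₑ ^ 2 ≤ eLpNorm (fun x => f x - Ω.indicator (H1rep u) x) 2 volume ^ 2
      + eLpNorm (fun x => G x - Ω.indicator (H1grad u) x) 2 volume ^ 2 := by
  rw [← lintegral_energy, eLpNorm_two_sq, eLpNorm_two_sq,
    ← lintegral_add_left' (hf.enorm.pow_const 2)]
  refine le_trans (lintegral_mono_ae ?_) (setLIntegral_le_lintegral Ω _)
  filter_upwards [H1rep_sub u v, H1grad_sub u v, hv, hvG, ae_restrict_mem hΩ.measurableSet]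
    with x a1 a2 a3 a4 hx
  rw [energy, a1, a2, a3, a4, indicator_of_mem hx, indicator_of_mem hx,
    enorm_sub_rev (H1rep u x), enorm_sub_rev (H1grad u x)]

/-- The mollified extension by zero is continuous everywhere, its weak gradient is the mollified
extension of `∇u`, and both are `L²`-close to the originals. -/
theorem H1tr0_subset_H1tilde (hΩ : IsOpen Ω) (hb : Bornology.IsBounded Ω) :
    H1tr0 Ω ⊆ H1tilde Ω := by
  intro u hu
  have := isFiniteMeasure_restrict hb
  have hΩm := hΩ.measurableSet
  set U := Ω.indicator (H1rep u) with hU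
  set G := Ω.indicator (H1grad u) with hG
  have hU2 : MemLp U 2 volume := (memLp_indicator_iff_restrict hΩm).2 (memLp_H1rep u)
  have hG2 : MemLp G 2 volume := (memLp_indicator_iff_restrict hΩm).2 (memLp_H1grad u)
  have hU1 : Integrable U := (integrable_indicator_iff hΩm).2
    ((memLp_H1rep u).integrable (by norm_num))
  have hG1 : Integrable G := (integrable_indicator_iff hΩm).2
    ((memLp_H1grad u).integrable (by norm_num))
  have hweak : ∀ v φ, IsTestFunction univ φ →
      ∫ x, U x * fderiv ℝ φ x v = - ∫ x, inner ℝ (G x) v * φ x := by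
    intro v φ hφ
    have h1 := integral_mul_fderiv_of_mem_H1tr0' hΩ hb hu hφ v
    rw [← integral_indicator hΩm, ← integral_indicator hΩm] at h1
    have e1 : ∀ x, U x * fderiv ℝ φ x v
        = Ω.indicator (fun x => H1rep u x * fderiv ℝ φ x v) x := fun x => by
      by_cases hx : x ∈ Ω <;> simp [hU, hx]
    have e2 : ∀ x, inner ℝ (G x) v * φ x
        = Ω.indicator (fun x => inner ℝ (H1grad u x) v * φ x) x := fun x => by
      by_cases hx : x ∈ Ω <;> simp [hG, hx]
    simp only [e1, e2, h1]
  refine EMetric.mem_closure_iff.2 fun ε hε => ?_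
  obtain ⟨η, hη0, hη⟩ : ∃ η : ℝ≥0∞, 0 < η ∧ η ^ 2 + η ^ 2 < ε ^ 2 := by
    have hcont : Continuous fun η : ℝ≥0∞ => η ^ 2 + η ^ 2 := by fun_prop
    have h1 : ∀ᶠ η in 𝓝[>] (0 : ℝ≥0∞), η ^ 2 + η ^ 2 < ε ^ 2 :=
      ((hcont.tendsto 0).mono_left nhdsWithin_le_nhds).eventually_lt_const (by simpa using ENNReal.pow_pos hε 2)
    obtain ⟨η, h2, h3⟩ := (h1.and self_mem_nhdsWithin).exists
    exact ⟨η, h3, h2⟩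
  obtain ⟨ρ, hρ, hρc, m1, m2⟩ := exists_mollifier hU1 hU2 hG1 hG2 hη0
  have hηtop : η ^ 2 ≠ ⊤ := fun h => by simp [h] at hη
  have c1 := continuous_mollify hρ hρc hU1
  have c2 := continuous_mollify hρ hρc hG1
  obtain ⟨v, hv1, hv2⟩ := exists_H1_of_isWeakGradient ((memLp_of_eLpNorm_sub_sq_le c1.aestronglyMeasurable hU2 hηtop m1).restrict Ω)
    ((memLp_of_eLpNorm_sub_sq_le c2.aestronglyMeasurable hG2 hηtop m2).restrict Ω) (by
    intro v φ hφ
    have hφ' : IsTestFunction univ φ := ⟨hφ.smooth, hφ.compact, subset_univ _⟩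
    -- Mollification tests `U` with translates of `φ`, which may leave `Ω`; hence the need for the
    -- identity `hweak` on the whole space.
    have h1 := IsWeakDirDeriv.mollify hρ hρc hU1 (hG1.inner_const v) (hweak v) hφ'
    simp only [inner_mollify hρ hρc hG1]
    rw [setIntegral_eq_integral_of_forall_compl_eq_zero, h1,
      setIntegral_eq_integral_of_forall_compl_eq_zero]
    · intro x hx
      rw [image_eq_zero_of_notMem_tsupport fun h' => hx (hφ.supp h'), mul_zero]
    · intro x hx
      rw [image_eq_zero_of_notMem_tsupport (f := fderiv ℝ φ)
        fun h' => hx (hφ.supp (tsupport_fderiv_subset ℝ h'))]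
      simp)
  refine ⟨v, ⟨_, c1.continuousOn, hv1⟩, ?_⟩
  have key : ‖u - v‖ₑ ^ 2 ≤ η ^ 2 + η ^ 2 :=
    (enorm_sub_sq_le hΩ (c1.aestronglyMeasurable.sub hU2.1) hv1 hv2).trans (add_le_add m1 m2)
  rw [edist_eq_enorm_sub]
  exact lt_of_not_ge fun h => (key.trans_lt hη).not_ge (by gcongr)

end

end OmniTrace

end

theorem mainTheorem4 (d : ℕ) (hd : 1 ≤ d) (Ω : Set (EuclideanSpace ℝ (Fin d)))
    (hΩ : IsOpen Ω) (hb : Bornology.IsBounded Ω) :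
    H10 Ω ⊆ H1tr0 Ω ∧ H1tr0 Ω ⊆ H1tilde Ω ∧ H1tilde Ω ⊆ H1tr Ω ∧
    ∀ u ∈ H1tilde Ω, ∃ g : EuclideanSpace ℝ (Fin d) → ℝ, IsOmniTrace u g ∧
      (∀ g', IsOmniTrace u g' → BdryEquiv Ω g' g) ∧
      ∀ (v : ℕ → H1 Ω) (f : ℕ → EuclideanSpace ℝ (Fin d) → ℝ),
        (∀ n, IsContRep (v n) (f n)) → Tendsto v atTop (𝓝 u) →
          Tendsto (fun n => bdryNorm Ω (f n - g)) atTop (𝓝 0) ∧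
          ∀ h, MemL2Bdry Ω h → Tendsto (fun n => bdryNorm Ω (f n - h)) atTop (𝓝 0) →
            BdryEquiv Ω h g := by
  refine ⟨H10_subset_H1tr0 hΩ hb, H1tr0_subset_H1tilde hΩ hb,
    fun u hu => exists_isOmniTrace hΩ hb hu, fun u hu => ?_⟩
  obtain ⟨g, hg⟩ := exists_isOmniTrace hΩ hb hu
  refine ⟨g, hg, fun g' hg' => hg.bdryEquiv hΩ hb hg', fun v f hf hv => ?_⟩
  have hlim := hg.tendsto_bdryNorm hΩ hb hf hv
  exact ⟨hlim, fun h hh hh' => BdryEquiv.of_tendsto hΩ hb hg.1 hh hf hlim hh'⟩
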